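/- Let $p,q\ge 0$ be integers, $n=p+q$, and $0\le r\le\infty$. Call a function on an open subset of $\mathbb{R}^p\times\mathbb{R}^q$ (coordinates $(x,y)$) of class $C^{\infty,r}$ if it is smooth in $x$ and all its partial derivatives in $x$, of every order $\ge 0$, are of class $C^r$ in $(x,y)$. Let $M$ be a Hausdorff $n$-manifold with a $p$-dimensional foliation $\mathcal{F}$ that is leafwise smooth and transversely $C^r$: $\mathcal{F}$ is given by an atlas of foliation charts with values in open subsets of $\mathbb{R}^p\times\mathbb{R}^q$ whose changes of charts have locally the form $(x,y)\mapsto(f(x,y),g(y))$ with $f$ of class $C^{\infty,r}$ and $g$ of class $C^r$; a foliation chart is any chart compatible in this sense with the atlas. (A smooth structure on $M$ in which the leaves are smoothly immersed may be present, but is not needed.) A leafwise $k$-form of $\mathcal{F}$ is an alternating $k$-form along the leaves which in foliation charts has the form $\sum_{I} a_I(x,y)\,dx^I$ with coefficients $a_I$ of class $C^{\infty,r}$. Let $d_{\mathcal F}$ be the exterior derivative along the leaves, and let $$H^k(\mathcal{F})=\ker\bigl(d_{\mathcal F}\colon \Omega^k(\mathcal F)\to\Omega^{k+1}(\mathcal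 F)\bigr)\big/ d_{\mathcal F}\,\Omega^{k-1}(\mathcal F)$$ (with $\Omega^{-1}(\mathcal F)=0$) be the leafwise de Rham cohomology, a real vector space. For a closed set $K\subset M$ let $\mathcal{F}_K$ be the foliation induced by $\mathcal{F}$ on $M\smallsetminus K$. Let $K\subset M$ be closed, and suppose that there is a foliation chart of $\mathcal{F}$ whose image is all of $\mathbb{R}^p\times\mathbb{R}^{q}$, by which we identify its domain with $\mathbb{R}^p\times\mathbb{R}^{q}$, such that: 1. $(0,0)\in K$; 2. there is a compact neighborhood $U$ of $0$ in $\mathbb{R}^p$ with smooth boundary $\partial U$ such that $(\partial U\times\{0\})\cap K=\varnothing$; 3. there is a sequence $(y_i)$ in $\mathbb{R}^{q}$ converging to $0$ such that $(U\times\{y_i\})\cap K=\varnothing$ for all $i$. Then $\dim_{\mathbb{R}} H^p(\mathcal{F}_K)=\infty$. -/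

import Mathlib

/-!
Leafwise smooth, transversely `C^r` foliations (`0 ≤ r ≤ ∞`) of dimension `p` and codimension `q`,
and their leafwise (foliated) de Rham cohomology.

A foliation of `M` is given by a foliated atlas, i.e. an instance
`ChartedSpace (FoliationModel p q) M` with `HasGroupoid M (foliationGroupoid p q r)`:
the changes of charts have the form `(x, y) ↦ (f (x, y), g y)` locally, where `g` is `C^r` and
`f` is smooth in `x` with all its `x`-derivatives of class `C^r`.
-/

open scoped ContDiff Topology Manifold

namespace LeafwiseDeRham

section Regularity

set_option linter.unusedSectionVars false

variable {V W : Type} {G G' G'' : Type*}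
  [NormedAddCommGroup V] [NormedSpace ℝ V] [NormedAddCommGroup W] [NormedSpace ℝ W]
  [NormedAddCommGroup G] [NormedSpace ℝ G] [NormedAddCommGroup G'] [NormedSpace ℝ G']
  [NormedAddCommGroup G''] [NormedSpace ℝ G'']

/-- The derivative of `f : V × W → G` at `z` in the leaf direction `V`. -/
noncomputable def leafDeriv (f : V × W → G) (z : V × W) : V →L[ℝ] G :=
  fderiv ℝ (fun x => f (x, z.2)) z.1

/-- `f` is leafwise smooth on the open set `s`, and `f` together with all its leafwise derivatives
is transversely of class `C^r`. The leafwise derivatives are required to be `C^r` jointly in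
`(x, y)`; given leafwise smoothness this amounts to the continuity on `s` of all the mixed
derivatives of order at most `r` in the transverse direction and of any order
in the leaf direction. -/
structure LeafwiseSmoothOn (r : ℕ∞) (f : V × W → G) (s : Set (V × W)) : Prop where
  smooth : ∀ z ∈ s, ContDiffAt ℝ ∞ (fun x => f (x, z.2)) z.1
  contDiffOn : ∀ k : ℕ, ContDiffOn ℝ r (fun z => iteratedFDeriv ℝ k (fun x => f (x, z.2)) z.1) s

/-- Auxiliary finite order version of `LeafwiseSmoothOn`, by recursion on the order. -/
def LeafwiseAux (r : ℕ∞) {V W : Type} [NormedAddCommGroup V] [NormedSpace ℝ V]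
    [NormedAddCommGroup W] [NormedSpace ℝ W] : ℕ → ∀ {G : Type*} [NormedAddCommGroup G]
    [NormedSpace ℝ G], (V × W → G) → Set (V × W) → Prop
  | 0, _, _, _, f, s => ContDiffOn ℝ r f s
  | k + 1, _, _, _, f, s => ContDiffOn ℝ r f s ∧
      (∀ z ∈ s, DifferentiableAt ℝ (fun x => f (x, z.2)) z.1) ∧ LeafwiseAux r k (leafDeriv f) s

variable {r : ℕ∞} {s : Set (V × W)}

theorem slice_mem_nhds (hs : IsOpen s) {z : V × W} (hz : z ∈ s) :
    ∀ᶠ x in 𝓝 z.1, (x, z.2) ∈ s :=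
  (Continuous.prodMk_left z.2).continuousAt.eventually (hs.mem_nhds hz)

theorem contDiffAt_slice_succ_iff (hs : IsOpen s) (f : V × W → G) (k : ℕ) :
    (∀ z ∈ s, ContDiffAt ℝ ((k + 1 : ℕ) : WithTop ℕ∞) (fun x => f (x, z.2)) z.1) ↔
      (∀ z ∈ s, DifferentiableAt ℝ (fun x => f (x, z.2)) z.1) ∧
      ∀ z ∈ s, ContDiffAt ℝ k (fun x => leafDeriv f (x, z.2)) z.1 := by
  have key : ∀ y : W, IsOpen {x : V | (x, y) ∈ s} := fun y =>
    hs.preimage (Continuous.prodMk_left y)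
  have conv : ∀ {G : Type _} [NormedAddCommGroup G] [NormedSpace ℝ G] (g : V × W → G)
      (n : WithTop ℕ∞), (∀ z ∈ s, ContDiffAt ℝ n (fun x => g (x, z.2)) z.1) ↔
      ∀ y : W, ContDiffOn ℝ n (fun x => g (x, y)) {x | (x, y) ∈ s} := by
    intro G _ _ g n
    refine ⟨fun h y x hx => (h (x, y) hx).contDiffWithinAt, fun h z hz => ?_⟩
    exact (h z.2).contDiffAt ((key z.2).mem_nhds hz)
  rw [conv, conv]
  have h1 : ∀ y : W, ContDiffOn ℝ ((k + 1 : ℕ) : WithTop ℕ∞) (fun x => f (x, y)) {x | (x, y) ∈ s} ↔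
      DifferentiableOn ℝ (fun x => f (x, y)) {x | (x, y) ∈ s} ∧
      ContDiffOn ℝ k (fun x => leafDeriv f (x, y)) {x | (x, y) ∈ s} := by
    intro y
    have := contDiffOn_succ_iff_fderiv_of_isOpen (𝕜 := ℝ) (n := (k : WithTop ℕ∞))
      (f := fun x => f (x, y)) (key y)
    simpa [leafDeriv] using this
  constructor
  · intro h
    refine ⟨fun z hz => ?_, fun y => ((h1 y).1 (h y)).2⟩
    exact ((h1 z.2).1 (h z.2)).1.differentiableAt ((key z.2).mem_nhds hz)
  · rintro ⟨ha, hb⟩ y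
    exact (h1 y).2 ⟨fun x hx => (ha (x, y) hx).differentiableWithinAt, hb y⟩

theorem leafwiseAux_iff (hs : IsOpen s) (f : V × W → G) (k : ℕ) :
    LeafwiseAux r k f s ↔
      (∀ z ∈ s, ContDiffAt ℝ k (fun x => f (x, z.2)) z.1) ∧
      ∀ j ≤ k, ContDiffOn ℝ r (fun z => iteratedFDeriv ℝ j (fun x => f (x, z.2)) z.1) s := by
  have zero : ∀ {G : Type _} [NormedAddCommGroup G] [NormedSpace ℝ G] (f : V × W → G),
      ContDiffOn ℝ r (fun z => iteratedFDeriv ℝ 0 (fun x => f (x, z.2)) z.1) s ↔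
        ContDiffOn ℝ r f s := by
    intro G _ _ f
    have : (fun z : V × W => iteratedFDeriv ℝ 0 (fun x => f (x, z.2)) z.1) =
        (continuousMultilinearCurryFin0 ℝ V G).symm ∘ f := by
      ext z; simp [iteratedFDeriv_zero_eq_comp]
    rw [this]
    exact (continuousMultilinearCurryFin0 ℝ V G).symm.toContinuousLinearEquiv.comp_contDiffOn_iff
  induction k generalizing G with
  | zero =>
    simp only [LeafwiseAux, Nat.le_zero, forall_eq]
    refine ⟨fun h => ⟨fun z hz => ?_, (zero f).2 h⟩, fun h => (zero f).1 h.2⟩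
    have hc : ContinuousOn f s := h.continuousOn
    simp only [Nat.cast_zero, contDiffAt_zero]
    refine ⟨{x | (x, z.2) ∈ s}, slice_mem_nhds hs hz, ?_⟩
    exact hc.comp (Continuous.prodMk_left z.2).continuousOn fun x hx => hx
  | succ k ih =>
    have step : ∀ j : ℕ,
        ContDiffOn ℝ r (fun z => iteratedFDeriv ℝ (j + 1) (fun x => f (x, z.2)) z.1) s ↔
        ContDiffOn ℝ r (fun z => iteratedFDeriv ℝ j (fun x => leafDeriv f (x, z.2)) z.1) s := by
      intro j
      have : (fun z : V × W => iteratedFDeriv ℝ (j + 1) (fun x => f (x, z.2)) z.1) =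
          (continuousMultilinearCurryRightEquiv' ℝ j V G).symm ∘
            fun z => iteratedFDeriv ℝ j (fun x => leafDeriv f (x, z.2)) z.1 := by
        funext z
        rw [iteratedFDeriv_succ_eq_comp_right]
        rfl
      have inv : (fun z : V × W => iteratedFDeriv ℝ j (fun x => leafDeriv f (x, z.2)) z.1) =
          (continuousMultilinearCurryRightEquiv' ℝ j V G) ∘
            fun z => iteratedFDeriv ℝ (j + 1) (fun x => f (x, z.2)) z.1 := by
        rw [this]
        funext z
        simp
      constructor
      · intro h
        rw [inv]
        exact (LinearIsometryEquiv.contDiff _).comp_contDiffOn h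
      · intro h
        rw [this]
        exact (LinearIsometryEquiv.contDiff _).comp_contDiffOn h
    rw [contDiffAt_slice_succ_iff hs]
    simp only [LeafwiseAux]
    have ih' := ih (leafDeriv f)
    constructor
    · rintro ⟨h0, hd, hkj⟩
      obtain ⟨hk, hj⟩ := ih'.1 hkj
      refine ⟨⟨hd, hk⟩, fun j hjk => ?_⟩
      cases j with
      | zero => exact (zero f).2 h0
      | succ j => exact (step j).2 (hj j (by omega))
    · rintro ⟨⟨hd, hk⟩, hj⟩
      exact ⟨(zero f).1 (hj 0 (by omega)), hd,
        ih'.2 ⟨hk, fun j hjk => (step j).1 (hj (j + 1) (by omega))⟩⟩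

theorem leafwiseSmoothOn_iff (hs : IsOpen s) (f : V × W → G) :
    LeafwiseSmoothOn r f s ↔ ∀ k, LeafwiseAux r k f s := by
  simp only [leafwiseAux_iff hs]
  constructor
  · exact fun h k => ⟨fun z hz => contDiffAt_infty.1 (h.smooth z hz) k, fun j _ => h.contDiffOn j⟩
  · exact fun h => ⟨fun z hz => contDiffAt_infty.2 fun k => (h k).1 z hz,
      fun k => (h k).2 k le_rfl⟩

namespace LeafwiseAux

theorem contDiffOn {k : ℕ} {f : V × W → G} (h : LeafwiseAux r k f s) : ContDiffOn ℝ r f s := by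
  cases k with
  | zero => exact h
  | succ k => exact h.1

theorem of_succ {k : ℕ} {f : V × W → G} (h : LeafwiseAux r (k + 1) f s) :
    LeafwiseAux r k f s := by
  induction k generalizing G with
  | zero => exact h.1
  | succ k ih => exact ⟨h.1, h.2.1, ih h.2.2⟩

theorem congr (hs : IsOpen s) {k : ℕ} {f g : V × W → G} (h : LeafwiseAux r k f s)
    (hfg : ∀ z ∈ s, g z = f z) : LeafwiseAux r k g s := by
  induction k generalizing G with
  | zero => exact ContDiffOn.congr h hfg
  | succ k ih =>
    have ev : ∀ z ∈ s, (fun x => g (x, z.2)) =ᶠ[𝓝 z.1] fun x => f (x, z.2) := fun z hz =>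
      (slice_mem_nhds hs hz).mono fun x hx => hfg _ hx
    refine ⟨h.1.congr hfg, fun z hz => ?_, ih h.2.2 fun z hz => ?_⟩
    · exact (h.2.1 z hz).congr_of_eventuallyEq (ev z hz)
    · exact (ev z hz).fderiv_eq

theorem mono {k : ℕ} {f : V × W → G} {t : Set (V × W)} (h : LeafwiseAux r k f s) (hts : t ⊆ s) :
    LeafwiseAux r k f t := by
  induction k generalizing G with
  | zero => exact ContDiffOn.mono h hts
  | succ k ih => exact ⟨h.1.mono hts, fun z hz => h.2.1 z (hts hz), ih h.2.2⟩

theorem add (hs : IsOpen s) {k : ℕ} {f g : V × W → G} (hf : LeafwiseAux r k f s)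
    (hg : LeafwiseAux r k g s) : LeafwiseAux r k (fun z => f z + g z) s := by
  induction k generalizing G with
  | zero => exact ContDiffOn.add hf hg
  | succ k ih =>
    refine ⟨hf.1.add hg.1, fun z hz => (hf.2.1 z hz).add (hg.2.1 z hz), ?_⟩
    refine (ih hf.2.2 hg.2.2).congr hs fun z hz => ?_
    exact fderiv_fun_add (hf.2.1 z hz) (hg.2.1 z hz)

theorem bilin (hs : IsOpen s) {k : ℕ} {G G' G'' : Type*}
    [NormedAddCommGroup G] [NormedSpace ℝ G] [NormedAddCommGroup G'] [NormedSpace ℝ G']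
    [NormedAddCommGroup G''] [NormedSpace ℝ G''] (B : G →L[ℝ] G' →L[ℝ] G'')
    {f : V × W → G} {g : V × W → G'} (hf : LeafwiseAux r k f s)
    (hg : LeafwiseAux r k g s) : LeafwiseAux r k (fun z => B (f z) (g z)) s := by
  induction k generalizing G G' G'' with
  | zero => exact B.isBoundedBilinearMap.contDiff.comp_contDiffOn (ContDiffOn.prodMk hf hg)
  | succ k ih =>
    refine ⟨B.isBoundedBilinearMap.contDiff.comp_contDiffOn (hf.1.prodMk hg.1), fun z hz => ?_, ?_⟩
    · exact (B.hasFDerivAt_of_bilinear (hf.2.1 z hz).hasFDerivAt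
        (hg.2.1 z hz).hasFDerivAt).differentiableAt
    · refine ((ih (B.precompR V) hf.of_succ hg.2.2).add hs
        (ih (B.precompL V) hf.2.2 hg.of_succ)).congr hs fun z hz => ?_
      exact (B.hasFDerivAt_of_bilinear (hf.2.1 z hz).hasFDerivAt
        (hg.2.1 z hz).hasFDerivAt).fderiv

theorem clm (hs : IsOpen s) {k : ℕ} {G G' : Type*}
    [NormedAddCommGroup G] [NormedSpace ℝ G] [NormedAddCommGroup G'] [NormedSpace ℝ G']
    (L : G →L[ℝ] G') {f : V × W → G} (hf : LeafwiseAux r k f s) :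
    LeafwiseAux r k (fun z => L (f z)) s := by
  induction k generalizing G G' with
  | zero => exact L.contDiff.comp_contDiffOn hf
  | succ k ih =>
    refine ⟨L.contDiff.comp_contDiffOn hf.1, fun z hz => ?_, ?_⟩
    · exact L.differentiableAt.comp z.1 (hf.2.1 z hz)
    · refine (ih (ContinuousLinearMap.compL ℝ V G G' L) hf.2.2).congr hs fun z hz => ?_
      exact (L.hasFDerivAt.comp z.1 (hf.2.1 z hz).hasFDerivAt).fderiv

/-- Composition with a map that sends leaves to leaves. -/
theorem comp (hs : IsOpen s) {k : ℕ} {τ : V × W → V × W} {t : Set (V × W)}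
    {f : V × W → G} (hf : LeafwiseAux r k f t)
    (hτ : LeafwiseAux r k (fun z => (τ z).1) s) (hτ₂ : ContDiffOn ℝ r (fun z => (τ z).2) s)
    (hleaf : ∀ z ∈ s, ∀ᶠ w in 𝓝 z, (τ w).2 = (τ (z.1, w.2)).2) (hst : Set.MapsTo τ s t) :
    LeafwiseAux r k (fun z => f (τ z)) s := by
  induction k generalizing G with
  | zero => exact ContDiffOn.comp hf (ContDiffOn.prodMk hτ hτ₂) hst
  | succ k ih =>
    have hd : ∀ z ∈ s, HasFDerivAt (fun x => f (τ (x, z.2)))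
        ((leafDeriv f (τ z)).comp (leafDeriv (fun z => (τ z).1) z)) z.1 := by
      intro z hz
      have h1 : HasFDerivAt (fun x => f (x, (τ z).2)) (leafDeriv f (τ z)) (τ z).1 :=
        (hf.2.1 _ (hst hz)).hasFDerivAt
      have h2 : HasFDerivAt (fun x => (τ (x, z.2)).1) (leafDeriv (fun z => (τ z).1) z) z.1 :=
        (hτ.2.1 z hz).hasFDerivAt
      refine (h1.comp z.1 h2).congr_of_eventuallyEq ?_
      have := (Continuous.prodMk_left (X := V) z.2).continuousAt (x := z.1)
        |>.eventually (hleaf z hz)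
      filter_upwards [this] with x hx
      simp only [Function.comp]
      rw [← Prod.mk.eta (p := τ (x, z.2)), hx]
    refine ⟨hf.1.comp (hτ.contDiffOn.prodMk hτ₂) hst, fun z hz => (hd z hz).differentiableAt, ?_⟩
    refine (bilin hs (ContinuousLinearMap.compL ℝ V V G) (ih hf.2.2 hτ.of_succ) hτ.2.2).congr hs
      fun z hz => ?_
    exact (hd z hz).fderiv

end LeafwiseAux

theorem LeafwiseSmoothOn.congr (hs : IsOpen s) {f g : V × W → G} (h : LeafwiseSmoothOn r f s)
    (hfg : ∀ z ∈ s, g z = f z) : LeafwiseSmoothOn r g s :=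
  (leafwiseSmoothOn_iff hs g).2 fun k => ((leafwiseSmoothOn_iff hs f).1 h k).congr hs hfg

theorem LeafwiseSmoothOn.add (hs : IsOpen s) {f g : V × W → G} (hf : LeafwiseSmoothOn r f s)
    (hg : LeafwiseSmoothOn r g s) : LeafwiseSmoothOn r (fun z => f z + g z) s :=
  (leafwiseSmoothOn_iff hs _).2 fun k =>
    ((leafwiseSmoothOn_iff hs f).1 hf k).add hs ((leafwiseSmoothOn_iff hs g).1 hg k)

theorem LeafwiseSmoothOn.clm (hs : IsOpen s) (L : G →L[ℝ] G') {f : V × W → G}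
    (hf : LeafwiseSmoothOn r f s) : LeafwiseSmoothOn r (fun z => L (f z)) s :=
  (leafwiseSmoothOn_iff hs _).2 fun k => ((leafwiseSmoothOn_iff hs f).1 hf k).clm hs L

theorem LeafwiseSmoothOn.leafDeriv (hs : IsOpen s) {f : V × W → G}
    (hf : LeafwiseSmoothOn r f s) : LeafwiseSmoothOn r (leafDeriv f) s :=
  (leafwiseSmoothOn_iff hs _).2 fun k => ((leafwiseSmoothOn_iff hs f).1 hf (k + 1)).2.2

theorem LeafwiseSmoothOn.differentiableAt {f : V × W → G}
    (hf : LeafwiseSmoothOn r f s) {z : V × W} (hz : z ∈ s) :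
    DifferentiableAt ℝ (fun x => f (x, z.2)) z.1 :=
  (hf.smooth z hz).differentiableAt (by simp)

theorem LeafwiseSmoothOn.mono {f : V × W → G} {t : Set (V × W)}
    (hf : LeafwiseSmoothOn r f s) (hts : t ⊆ s) : LeafwiseSmoothOn r f t :=
  ⟨fun z hz => hf.smooth z (hts hz), fun k => (hf.contDiffOn k).mono hts⟩

theorem leafwiseSmoothOn_fst (hs : IsOpen s) :
    LeafwiseSmoothOn r (fun z : V × W => z.1) s := by
  have const : ∀ (k : ℕ) {G : Type} [NormedAddCommGroup G] [NormedSpace ℝ G] (c : G),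
      LeafwiseAux r k (fun _ : V × W => c) s := by
    intro k
    induction k with
    | zero => intro G _ _ c; exact contDiffOn_const
    | succ k ih =>
      intro G _ _ c
      refine ⟨contDiffOn_const, fun z _ => differentiableAt_const c, ?_⟩
      exact (ih (0 : V →L[ℝ] G)).congr hs fun z _ => by simp [leafDeriv]
  refine (leafwiseSmoothOn_iff hs _).2 fun k => ?_
  cases k with
  | zero => exact contDiffOn_fst
  | succ k =>
    refine ⟨contDiffOn_fst, fun z _ => differentiableAt_id, ?_⟩
    exact (const k (ContinuousLinearMap.id ℝ V)).congr hs fun z _ => by simp [leafDeriv]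

end Regularity

section Groupoid

/-- The model `ℝ^p × ℝ^q`, foliated by the leaves `ℝ^p × {y}`. -/
abbrev FoliationModel (p q : ℕ) : Type := EuclideanSpace ℝ (Fin p) × EuclideanSpace ℝ (Fin q)

variable {p q : ℕ}

/-- On the open set `s` the map `τ` has locally the form `(x, y) ↦ (f (x, y), g y)` with `g` of
class `C^r` and `f` leafwise smooth and, with its leafwise derivatives, transversely `C^r`. -/
structure IsFoliatedOn (r : ℕ∞) (τ : FoliationModel p q → FoliationModel p q)
    (s : Set (FoliationModel p q)) : Prop where
  leafwise : LeafwiseSmoothOn r (fun z => (τ z).1) s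
  transverse : ContDiffOn ℝ r (fun z => (τ z).2) s
  preserves : ∀ z ∈ s, ∀ᶠ w in 𝓝 z, (τ w).2 = (τ (z.1, w.2)).2

theorem IsFoliatedOn.comp_leafwise {r : ℕ∞} {τ : FoliationModel p q → FoliationModel p q}
    {s t : Set (FoliationModel p q)} {G : Type*} [NormedAddCommGroup G] [NormedSpace ℝ G]
    {f : FoliationModel p q → G} (hs : IsOpen s) (ht : IsOpen t) (hτ : IsFoliatedOn r τ s)
    (hf : LeafwiseSmoothOn r f t) (hst : Set.MapsTo τ s t) :
    LeafwiseSmoothOn r (fun z => f (τ z)) s :=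
  (leafwiseSmoothOn_iff hs _).2 fun k =>
    ((leafwiseSmoothOn_iff ht f).1 hf k).comp hs
      ((leafwiseSmoothOn_iff hs _).1 hτ.leafwise k) hτ.transverse hτ.preserves hst

theorem IsFoliatedOn.mono {r : ℕ∞} {τ : FoliationModel p q → FoliationModel p q}
    {s t : Set (FoliationModel p q)} (h : IsFoliatedOn r τ s) (hts : t ⊆ s) :
    IsFoliatedOn r τ t :=
  ⟨h.leafwise.mono hts, h.transverse.mono hts, fun z hz => h.preserves z (hts hz)⟩

theorem IsFoliatedOn.continuousOn {r : ℕ∞} {τ : FoliationModel p q → FoliationModel p q}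
    {s : Set (FoliationModel p q)} (hs : IsOpen s) (h : IsFoliatedOn r τ s) : ContinuousOn τ s :=
  ((leafwiseSmoothOn_iff hs _).1 h.leafwise 0).contDiffOn.continuousOn.prodMk
    h.transverse.continuousOn

theorem tendsto_slice (z : FoliationModel p q) :
    Filter.Tendsto (fun w : FoliationModel p q => (z.1, w.2)) (𝓝 z) (𝓝 z) := by
  have : Continuous fun w : FoliationModel p q => (z.1, w.2) := by fun_prop
  simpa using this.tendsto z

theorem isFoliatedOn_id (r : ℕ∞) {s : Set (FoliationModel p q)} (hs : IsOpen s) :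
    IsFoliatedOn r id s :=
  ⟨leafwiseSmoothOn_fst hs, contDiffOn_snd, fun _ _ => Filter.Eventually.of_forall fun _ => rfl⟩

/-- Foliated maps of `ℝ^p × ℝ^q`, smooth along the leaves and transversely `C^r`. -/
def foliationPregroupoid (p q : ℕ) (r : ℕ∞) : Pregroupoid (FoliationModel p q) where
  property := IsFoliatedOn r
  comp := by
    intro f g u v hf hg hu hv huv
    have hf' : IsFoliatedOn r f (u ∩ f ⁻¹' v) := hf.mono Set.inter_subset_left
    have hmaps : Set.MapsTo f (u ∩ f ⁻¹' v) v := fun z hz => hz.2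
    refine ⟨hf'.comp_leafwise (f := fun z => (g z).1) huv hv hg.leafwise hmaps, ?_, fun z hz => ?_⟩
    · exact hg.transverse.comp (((leafwiseSmoothOn_iff huv _).1 hf'.leafwise 0).contDiffOn.prodMk
        hf'.transverse) hmaps
    · have hc : ContinuousAt f z := (hf.continuousOn hu).continuousAt (hu.mem_nhds hz.1)
      have h1 := hc.eventually (hg.preserves (f z) hz.2)
      have h2 := (hc.tendsto.comp (tendsto_slice z)).eventually (hg.preserves (f z) hz.2)
      filter_upwards [h1, h2, hf.preserves z hz.1] with w hw1 hw2 hw3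
      simp only [Function.comp] at hw2 ⊢
      rw [hw1, hw2, hw3]
  id_mem := isFoliatedOn_id r isOpen_univ
  locality := by
    intro f u hu h
    choose! v hv hxv hp using h
    refine ⟨⟨fun z hz => (hp z hz).leafwise.smooth z ⟨hz, hxv z hz⟩, fun k z hz => ?_⟩,
      fun z hz => ?_, fun z hz => (hp z hz).preserves z ⟨hz, hxv z hz⟩⟩
    · exact (((hp z hz).leafwise.contDiffOn k).contDiffAt
        ((hu.inter (hv z hz)).mem_nhds ⟨hz, hxv z hz⟩)).contDiffWithinAt
    · exact ((hp z hz).transverse.contDiffAt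
        ((hu.inter (hv z hz)).mem_nhds ⟨hz, hxv z hz⟩)).contDiffWithinAt
  congr := by
    intro f g u hu hfg hf
    refine ⟨hf.leafwise.congr hu fun z hz => by rw [hfg z hz],
      hf.transverse.congr fun z hz => by rw [hfg z hz], fun z hz => ?_⟩
    have h2 := (tendsto_slice z).eventually (hu.mem_nhds hz)
    filter_upwards [hf.preserves z hz, hu.mem_nhds hz, h2] with w h1 hw hw2
    rw [hfg w hw, hfg _ hw2, h1]

/-- The pseudogroup of changes of foliation charts: homeomorphisms between open subsets of
`ℝ^p × ℝ^q` that are foliated, leafwise smooth and transversely `C^r`, with their inverses. -/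
def foliationGroupoid (p q : ℕ) (r : ℕ∞) : StructureGroupoid (FoliationModel p q) :=
  (foliationPregroupoid p q r).groupoid

instance (p q : ℕ) (r : ℕ∞) : ClosedUnderRestriction (foliationGroupoid p q r) :=
  (closedUnderRestriction_iff_id_le _).mpr <| by
    rw [StructureGroupoid.le_iff]
    rintro e ⟨s, hs, hes⟩
    refine (foliationGroupoid p q r).mem_of_eqOnSource ?_ hes
    exact ⟨isFoliatedOn_id r hs, isFoliatedOn_id r hs⟩

end Groupoid

section Forms

variable (p q : ℕ) (r : ℕ∞) (X : Type*) [TopologicalSpace X] [ChartedSpace (FoliationModel p q) X]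

/-- The foliation charts of the foliated space `X`: all the charts compatible with its atlas. -/
abbrev FoliationChart := (foliationGroupoid p q r).maximalAtlas X

/-- Families of maps from `ℝ^p × ℝ^q` to the alternating `k`-forms on `ℝ^p`, one for each foliation
chart. -/
def FormFamily (k : ℕ) : Type _ :=
  FoliationChart p q r X → FoliationModel p q → EuclideanSpace ℝ (Fin p) [⋀^Fin k]→L[ℝ] ℝ

noncomputable instance (k : ℕ) : AddCommGroup (FormFamily p q r X k) :=
  inferInstanceAs (AddCommGroup (FoliationChart p q r X → FoliationModel p q →
    EuclideanSpace ℝ (Fin p) [⋀^Fin k]→L[ℝ] ℝ))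

noncomputable instance (k : ℕ) : Module ℝ (FormFamily p q r X k) :=
  inferInstanceAs (Module ℝ (FoliationChart p q r X → FoliationModel p q →
    EuclideanSpace ℝ (Fin p) [⋀^Fin k]→L[ℝ] ℝ))

variable {p q r X} in
theorem FormFamily.add_apply {k : ℕ} (α β : FormFamily p q r X k) (φ : FoliationChart p q r X)
    (z : FoliationModel p q) : (α + β) φ z = α φ z + β φ z := rfl

variable {p q r X} in
theorem FormFamily.smul_apply {k : ℕ} (c : ℝ) (α : FormFamily p q r X k)
    (φ : FoliationChart p q r X) (z : FoliationModel p q) : (c • α) φ z = c • α φ z := rfl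

variable {p q r X} in
theorem FormFamily.zero_apply {k : ℕ} (φ : FoliationChart p q r X) (z : FoliationModel p q) :
    (0 : FormFamily p q r X k) φ z = 0 := rfl

/-- Leafwise `k`-forms on `X`: families of forms `α_φ`, one on the image of each
foliation chart `φ`, with values in the alternating `k`-forms on the leaf direction `ℝ^p`,
which are leafwise smooth and, with all their leafwise derivatives, transversely `C^r`, and which
correspond to each other under the changes of charts (pullback along the leaves).
Outside of the image of the chart the value is `0` by convention. -/
def leafwiseForms (k : ℕ) : Submodule ℝ (FormFamily p q r X k) where
  carrier := {α | (∀ φ, LeafwiseSmoothOn r (α φ) φ.1.target) ∧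
    (∀ φ, ∀ z ∉ φ.1.target, α φ z = 0) ∧
    ∀ φ ψ : FoliationChart p q r X, ∀ z ∈ (φ.1.symm ≫ₕ ψ.1).source,
      α φ z = (α ψ (ψ.1 (φ.1.symm z))).compContinuousLinearMap
        (leafDeriv (fun w => (ψ.1 (φ.1.symm w)).1) z)}
  add_mem' := by
    rintro α η ⟨h1, h2, h3⟩ ⟨g1, g2, g3⟩
    refine ⟨fun φ => (h1 φ).add φ.1.open_target (g1 φ), fun φ z hz => ?_, fun φ ψ z hz => ?_⟩
    · simp [FormFamily.add_apply, h2 φ z hz, g2 φ z hz]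
    · simp only [FormFamily.add_apply, h3 φ ψ z hz, g3 φ ψ z hz]
      ext v; simp
  zero_mem' := by
    refine ⟨fun φ => ⟨fun z _ => contDiffAt_const, fun k => ?_⟩, fun φ z _ => rfl,
      fun φ ψ z _ => by ext v; simp [FormFamily.zero_apply]⟩
    simp only [FormFamily.zero_apply, iteratedFDeriv_fun_zero]
    exact contDiffOn_const
  smul_mem' := by
    rintro c α ⟨h1, h2, h3⟩
    refine ⟨fun φ => ?_, fun φ z hz => ?_, fun φ ψ z hz => ?_⟩
    · exact (h1 φ).clm φ.1.open_target (c • ContinuousLinearMap.id ℝ _)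
    · simp [FormFamily.smul_apply, h2 φ z hz]
    · simp only [FormFamily.smul_apply, h3 φ ψ z hz]
      ext v; simp

variable {p q r X}

/-- The exterior derivative along the leaves `ℝ^p × {y}`, in a chart. -/
noncomputable def leafExtDeriv {k : ℕ}
    (α : FoliationModel p q → EuclideanSpace ℝ (Fin p) [⋀^Fin k]→L[ℝ] ℝ) (z : FoliationModel p q) :
    EuclideanSpace ℝ (Fin p) [⋀^Fin (k + 1)]→L[ℝ] ℝ :=
  extDeriv (fun x => α (x, z.2)) z.1

theorem leafExtDeriv_smooth {k : ℕ} {s : Set (FoliationModel p q)} (hs : IsOpen s)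
    {α : FoliationModel p q → EuclideanSpace ℝ (Fin p) [⋀^Fin k]→L[ℝ] ℝ}
    (h : LeafwiseSmoothOn r α s) : LeafwiseSmoothOn r (leafExtDeriv α) s :=
  (h.leafDeriv hs).clm hs
    (ContinuousAlternatingMap.alternatizeUncurryFinCLM ℝ (EuclideanSpace ℝ (Fin p)) ℝ)

theorem leafExtDeriv_compat {k : ℕ} (α : leafwiseForms p q r X k) (φ ψ : FoliationChart p q r X)
    {z : FoliationModel p q} (hz : z ∈ (φ.1.symm ≫ₕ ψ.1).source) :
    leafExtDeriv (α.1 φ) z = (leafExtDeriv (α.1 ψ) (ψ.1 (φ.1.symm z))).compContinuousLinearMap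
      (leafDeriv (fun w => (ψ.1 (φ.1.symm w)).1) z) := by
  obtain ⟨α, h1, h2, h3⟩ := α
  have hτ : IsFoliatedOn r (fun w => ψ.1 (φ.1.symm w)) (φ.1.symm ≫ₕ ψ.1).source :=
    ((foliationGroupoid p q r).compatible_of_mem_maximalAtlas φ.2 ψ.2).1
  have hzt : ψ.1 (φ.1.symm z) ∈ ψ.1.target := ψ.1.map_source (by simpa using hz.2)
  have hopen := (φ.1.symm ≫ₕ ψ.1).open_source
  set f : EuclideanSpace ℝ (Fin p) → EuclideanSpace ℝ (Fin p) :=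
    fun x => (ψ.1 (φ.1.symm (x, z.2))).1 with hf
  set c := (ψ.1 (φ.1.symm z)).2 with hc
  have ev : (fun x => α φ (x, z.2)) =ᶠ[𝓝 z.1]
      fun x => (α ψ (f x, c)).compContinuousLinearMap (fderiv ℝ f x) := by
    have hl := (Continuous.prodMk_left (X := EuclideanSpace ℝ (Fin p)) z.2).continuousAt (x := z.1)
      |>.eventually (hτ.preserves z hz)
    filter_upwards [hl, slice_mem_nhds hopen hz] with x hx hxs
    rw [h3 φ ψ _ hxs]
    have : ψ.1 (φ.1.symm (x, z.2)) = (f x, c) := Prod.ext rfl hx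
    rw [this]
    rfl
  have hz' : (f z.1, c) = ψ.1 (φ.1.symm z) := rfl
  simp only [leafExtDeriv]
  rw [ev.extDeriv_eq]
  have hd : DifferentiableAt ℝ (fun x => α ψ (x, c)) (f z.1) := (h1 ψ).differentiableAt hzt
  have hfs : ContDiffAt ℝ 2 f z.1 := contDiffAt_infty.1 (hτ.leafwise.smooth z hz) 2
  exact extDeriv_pullback hd hfs (by simp)

/-- The leafwise exterior derivative on leafwise forms. -/
noncomputable def leafwiseD (p q : ℕ) (r : ℕ∞) (X : Type*) [TopologicalSpace X]
    [ChartedSpace (FoliationModel p q) X] (k : ℕ) :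
    leafwiseForms p q r X k →ₗ[ℝ] leafwiseForms p q r X (k + 1) where
  toFun α := ⟨fun φ => φ.1.target.indicator (leafExtDeriv (α.1 φ)), by
    refine ⟨fun φ => ?_, fun φ z hz => Set.indicator_of_notMem hz _, fun φ ψ z hz => ?_⟩
    · exact (leafExtDeriv_smooth φ.1.open_target (α.2.1 φ)).congr φ.1.open_target
        fun z hz => Set.indicator_of_mem hz _
    · have h1 : z ∈ φ.1.target := hz.1
      have h2 : ψ.1 (φ.1.symm z) ∈ ψ.1.target := ψ.1.map_source (by simpa using hz.2)
      beta_reduce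
      rw [Set.indicator_of_mem h1, Set.indicator_of_mem h2]
      exact leafExtDeriv_compat α φ ψ hz⟩
  map_add' α η := by
    ext1
    funext φ z
    change φ.1.target.indicator (leafExtDeriv fun w => α.1 φ w + η.1 φ w) z =
      φ.1.target.indicator (leafExtDeriv (α.1 φ)) z + φ.1.target.indicator (leafExtDeriv (η.1 φ)) z
    by_cases hz : z ∈ φ.1.target
    · simp only [Set.indicator_of_mem hz]
      exact extDeriv_fun_add ((α.2.1 φ).differentiableAt hz) ((η.2.1 φ).differentiableAt hz)
    · simp [Set.indicator_of_notMem hz]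
  map_smul' c α := by
    ext1
    funext φ z
    change φ.1.target.indicator (leafExtDeriv fun w => c • α.1 φ w) z =
      c • φ.1.target.indicator (leafExtDeriv (α.1 φ)) z
    by_cases hz : z ∈ φ.1.target
    · simp only [Set.indicator_of_mem hz]
      exact extDeriv_smul c fun x => α.1 φ (x, z.2)
    · simp [Set.indicator_of_notMem hz]

theorem leafwiseD_leafwiseD {k : ℕ} (α : leafwiseForms p q r X k) :
    leafwiseD p q r X (k + 1) (leafwiseD p q r X k α) = 0 := by
  ext1
  funext φ z
  change φ.1.target.indicator (leafExtDeriv (φ.1.target.indicator (leafExtDeriv (α.1 φ)))) z = 0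
  by_cases hz : z ∈ φ.1.target
  · rw [Set.indicator_of_mem hz, leafExtDeriv]
    have ev : (fun x => φ.1.target.indicator (leafExtDeriv (α.1 φ)) (x, z.2)) =ᶠ[𝓝 z.1]
        extDeriv fun x => α.1 φ (x, z.2) :=
      (slice_mem_nhds φ.1.open_target hz).mono fun x hx => Set.indicator_of_mem hx _
    rw [ev.extDeriv_eq]
    exact extDeriv_extDeriv_apply (contDiffAt_infty.1 ((α.2.1 φ).smooth z hz) 2) (by simp)
  · exact Set.indicator_of_notMem hz _

/-- The exact leafwise `k`-forms; there are no forms of degree `-1`. -/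
noncomputable def exactForms (p q : ℕ) (r : ℕ∞) (X : Type*) [TopologicalSpace X]
    [ChartedSpace (FoliationModel p q) X] : ∀ k : ℕ, Submodule ℝ (leafwiseForms p q r X k)
  | 0 => ⊥
  | k + 1 => LinearMap.range (leafwiseD p q r X k)

/-- The leafwise de Rham cohomology `H^k` of the foliation of `X`: closed modulo exact forms. -/
abbrev LeafwiseCohomology (p q : ℕ) (r : ℕ∞) (X : Type*) [TopologicalSpace X]
    [ChartedSpace (FoliationModel p q) X] (k : ℕ) : Type _ :=
  LinearMap.ker (leafwiseD p q r X k) ⧸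
    (exactForms p q r X k).submoduleOf (LinearMap.ker (leafwiseD p q r X k))

end Forms

/-- The set `U ⊆ ℝ^p` has smooth boundary: near each of its frontier points it is the
sublevel set `{f ≤ 0}` of a smooth function without critical point there. -/
def HasSmoothBoundary {p : ℕ} (U : Set (EuclideanSpace ℝ (Fin p))) : Prop :=
  ∀ x ∈ frontier U, ∃ f : EuclideanSpace ℝ (Fin p) → ℝ, ContDiff ℝ ∞ f ∧ fderiv ℝ f x ≠ 0 ∧
    ∀ᶠ w in 𝓝 x, w ∈ U ↔ f w ≤ 0

end LeafwiseDeRham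

open LeafwiseDeRham

/-! In the given chart let `s = 1 / (|x|² + |y|²)`. It is smooth away from the origin, and the
origin lies in `K`. For a real polynomial `P` put `ω_P = h P(s) s^(p+2) dx¹ ∧ ⋯ ∧ dx^p`, with `h` a
compactly supported cutoff equal to `1` near the origin. Extended by zero, `ω_P` is a leafwise form
on `M ∖ K`, closed because its degree is `p`. It is shown that `P ↦ [ω_P]` is injective; as `ℝ[X]`
has infinite dimension, so has the cohomology.

The obstruction to exactness is the behaviour of integrals over the plaques `U × {y_i}`, which miss
`K` and converge to a plaque meeting it. Let `χ` be a cutoff in `x` supported in `U` and equal to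
`1` near the points `x` of `U` with `(x, 0) ∈ K`; it exists because `∂U × {0}` misses `K`. If `ω =
dη`, integration by parts turns `∫ χ ω` over the plaque at `y_i` into integrals of coefficients of
`η` against derivatives of `χ`. The support of `dχ` times `{0} ∪ {y_i}` is a compact subset of `M ∖
K`, so these integrals are bounded in `i` (`exists_bound_of_mem_exactForms`). In degree `0`
exactness means vanishing and the bound is trivial.

For `P` with positive leading coefficient, on the other hand, `∫ χ ω_P` over these plaques tends to
infinity (`tendsto_integral_mul_eval_invSqDist`), so `ω_P` is not exact. Passing to `-P` covers
every nonzero `P`. -/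

namespace LeafwiseDeRham

/-! ### Closure properties of leafwise smooth functions -/

section Regularity

variable {V W : Type} [NormedAddCommGroup V] [NormedSpace ℝ V]
  [NormedAddCommGroup W] [NormedSpace ℝ W] {r : ℕ∞} {s : Set (V × W)}

/-- By the chain rule the leafwise derivative is `fderiv ℝ g (f z)` composed with that of `f`. The
induction on the order therefore runs over all smooth `g`, with varying codomain. -/
theorem LeafwiseAux.contDiff_comp (hs : IsOpen s) {k : ℕ} {G G' : Type}
    [NormedAddCommGroup G] [NormedSpace ℝ G] [NormedAddCommGroup G'] [NormedSpace ℝ G']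
    {g : G → G'} (hg : ContDiff ℝ ∞ g) {f : V × W → G} (hf : LeafwiseAux r k f s) :
    LeafwiseAux r k (fun z => g (f z)) s := by
  have hgr : ContDiff ℝ r g := hg.of_le (by exact_mod_cast le_top)
  induction k generalizing G' with
  | zero => exact hgr.comp_contDiffOn hf
  | succ k ih =>
    have hd : ∀ z ∈ s, HasFDerivAt (fun x => g (f (x, z.2)))
        ((fderiv ℝ g (f z)).comp (LeafwiseDeRham.leafDeriv f z)) z.1 := fun z hz =>
      ((hg.differentiable (by simp)).differentiableAt.hasFDerivAt (x := f z)).comp z.1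
        (hf.2.1 z hz).hasFDerivAt
    have hg' : ContDiff ℝ ∞ (fderiv ℝ g) := hg.fderiv_right (by simp)
    refine ⟨hgr.comp_contDiffOn hf.1, fun z hz => (hd z hz).differentiableAt, ?_⟩
    refine (bilin hs (ContinuousLinearMap.compL ℝ V G G')
      (ih hg' hf.of_succ (hg'.of_le (by exact_mod_cast le_top))) hf.2.2).congr hs fun z hz => ?_
    exact (hd z hz).fderiv

theorem LeafwiseSmoothOn.contDiff_comp (hs : IsOpen s) {G G' : Type}
    [NormedAddCommGroup G] [NormedSpace ℝ G] [NormedAddCommGroup G'] [NormedSpace ℝ G']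
    {g : G → G'} (hg : ContDiff ℝ ∞ g) {f : V × W → G} (hf : LeafwiseSmoothOn r f s) :
    LeafwiseSmoothOn r (fun z => g (f z)) s :=
  (leafwiseSmoothOn_iff hs _).2 fun k => ((leafwiseSmoothOn_iff hs f).1 hf k).contDiff_comp hs hg

theorem LeafwiseSmoothOn.bilin (hs : IsOpen s) {G G' G'' : Type*}
    [NormedAddCommGroup G] [NormedSpace ℝ G] [NormedAddCommGroup G'] [NormedSpace ℝ G']
    [NormedAddCommGroup G''] [NormedSpace ℝ G''] (B : G →L[ℝ] G' →L[ℝ] G'')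
    {f : V × W → G} {g : V × W → G'} (hf : LeafwiseSmoothOn r f s)
    (hg : LeafwiseSmoothOn r g s) : LeafwiseSmoothOn r (fun z => B (f z) (g z)) s :=
  (leafwiseSmoothOn_iff hs _).2 fun k =>
    ((leafwiseSmoothOn_iff hs f).1 hf k).bilin hs B ((leafwiseSmoothOn_iff hs g).1 hg k)

theorem LeafwiseSmoothOn.continuousOn (hs : IsOpen s) {G : Type*} [NormedAddCommGroup G]
    [NormedSpace ℝ G] {f : V × W → G} (hf : LeafwiseSmoothOn r f s) : ContinuousOn f s :=
  ((leafwiseSmoothOn_iff hs f).1 hf 0).contDiffOn.continuousOn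

/-- Functions that are jointly smooth are leafwise smooth and transversely `C^r` for every `r`. -/
theorem leafwiseSmoothOn_of_contDiffOn (hs : IsOpen s) {G : Type*} [NormedAddCommGroup G]
    [NormedSpace ℝ G] {f : V × W → G} (hf : ContDiffOn ℝ ∞ f s) : LeafwiseSmoothOn r f s := by
  refine (leafwiseSmoothOn_iff hs _).2 fun k => ?_
  induction k generalizing G with
  | zero => exact hf.of_le (by exact_mod_cast le_top)
  | succ k ih =>
    have hd : ∀ z ∈ s, HasFDerivAt (fun x => f (x, z.2))
        ((fderiv ℝ f z).comp (ContinuousLinearMap.inl ℝ V W)) z.1 := fun z hz =>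
      ((hf.contDiffAt (hs.mem_nhds hz)).differentiableAt (by simp)).hasFDerivAt.comp z.1
        (hasFDerivAt_prodMk_left z.1 z.2)
    refine ⟨hf.of_le (by exact_mod_cast le_top), fun z hz => (hd z hz).differentiableAt, ?_⟩
    have hf' : ContDiffOn ℝ ∞ (fun z => (fderiv ℝ f z).comp (ContinuousLinearMap.inl ℝ V W)) s :=
      (hf.fderiv_of_isOpen hs (by simp)).clm_comp contDiffOn_const
    exact (ih hf').congr hs fun z hz => (hd z hz).fderiv

theorem leafwiseSmoothOn_of_locally {G : Type*} [NormedAddCommGroup G] [NormedSpace ℝ G]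
    {f : V × W → G} (h : ∀ z ∈ s, ∃ u, IsOpen u ∧ z ∈ u ∧ LeafwiseSmoothOn r f u) :
    LeafwiseSmoothOn r f s := by
  choose! u hu hzu hf using h
  exact ⟨fun z hz => (hf z hz).smooth z (hzu z hz), fun k z hz =>
    (((hf z hz).contDiffOn k).contDiffAt ((hu z hz).mem_nhds (hzu z hz))).contDiffWithinAt⟩

end Regularity

/-! ### Changes of foliation charts -/

section ChartTransition

variable {p q : ℕ} {r : ℕ∞}

/-- The chain rule for leafwise derivatives. -/
theorem IsFoliatedOn.leafDeriv_comp {τ : FoliationModel p q → FoliationModel p q}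
    {s : Set (FoliationModel p q)} (hτ : IsFoliatedOn r τ s) {z : FoliationModel p q} (hz : z ∈ s)
    {G : Type*} [NormedAddCommGroup G] [NormedSpace ℝ G] {f : FoliationModel p q → G}
    (hf : DifferentiableAt ℝ (fun x => f (x, (τ z).2)) (τ z).1) :
    leafDeriv (fun w => f (τ w)) z =
      (leafDeriv f (τ z)).comp (leafDeriv (fun w => (τ w).1) z) := by
  have h1 : HasFDerivAt (fun x => f (x, (τ z).2)) (leafDeriv f (τ z)) (τ z).1 := hf.hasFDerivAt
  have h2 : HasFDerivAt (fun x => (τ (x, z.2)).1) (leafDeriv (fun w => (τ w).1) z) z.1 :=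
    (hτ.leafwise.differentiableAt hz).hasFDerivAt
  refine HasFDerivAt.fderiv (HasFDerivAt.congr_of_eventuallyEq (h1.comp z.1 h2) ?_)
  have := (Continuous.prodMk_left (X := EuclideanSpace ℝ (Fin p)) z.2).continuousAt (x := z.1)
    |>.eventually (hτ.preserves z hz)
  filter_upwards [this] with x hx
  simp only [Function.comp]
  rw [← Prod.mk.eta (p := τ (x, z.2)), hx]

theorem leafDeriv_congr {G : Type*} [NormedAddCommGroup G] [NormedSpace ℝ G]
    {f g : FoliationModel p q → G} {z : FoliationModel p q} (h : f =ᶠ[𝓝 z] g) :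
    leafDeriv f z = leafDeriv g z :=
  Filter.EventuallyEq.fderiv_eq <|
    (Continuous.prodMk_left (X := EuclideanSpace ℝ (Fin p)) z.2).continuousAt (x := z.1)
      |>.eventually h

variable {X : Type*} [TopologicalSpace X] [ChartedSpace (FoliationModel p q) X]

theorem FoliationChart.mem_transition_source (φ ψ : FoliationChart p q r X)
    {z : FoliationModel p q} :
    z ∈ (φ.1.symm ≫ₕ ψ.1).source ↔ z ∈ φ.1.target ∧ φ.1.symm z ∈ ψ.1.source :=
  Iff.rfl

theorem FoliationChart.isFoliatedOn_transition (φ ψ : FoliationChart p q r X) :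
    IsFoliatedOn r (fun w => ψ.1 (φ.1.symm w)) (φ.1.symm ≫ₕ ψ.1).source :=
  ((foliationGroupoid p q r).compatible_of_mem_maximalAtlas φ.2 ψ.2).1

end ChartTransition

/-! ### Forms of top degree on `ℝ^p` -/

section Volume

variable {p : ℕ}

/-- The standard volume form of `ℝ^p`. -/
noncomputable def leafVolume (p : ℕ) : EuclideanSpace ℝ (Fin p) [⋀^Fin p]→L[ℝ] ℝ :=
  { (EuclideanSpace.basisFun (Fin p) ℝ).toBasis.det with
    cont := by
      change Continuous fun v => (EuclideanSpace.basisFun (Fin p) ℝ).toBasis.det v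
      simp only [Module.Basis.det_apply]
      refine Continuous.matrix_det (continuous_matrix fun i j => ?_)
      simp only [Module.Basis.toMatrix_apply, OrthonormalBasis.coe_toBasis_repr_apply,
        EuclideanSpace.basisFun_repr]
      fun_prop }

theorem leafVolume_basis : leafVolume p (EuclideanSpace.basisFun (Fin p) ℝ) = 1 := by
  have := (EuclideanSpace.basisFun (Fin p) ℝ).toBasis.det_self
  rwa [OrthonormalBasis.coe_toBasis] at this

/-- Top forms make up a line spanned by the volume form. The factor is the determinant of `L`,
written as a multilinear expression in the vectors `L e_i`, which makes its smoothness in `L`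
immediate. -/
theorem leafVolume_comp (L : EuclideanSpace ℝ (Fin p) →L[ℝ] EuclideanSpace ℝ (Fin p)) :
    (leafVolume p).compContinuousLinearMap L =
      leafVolume p (fun i => L (EuclideanSpace.basisFun (Fin p) ℝ i)) • leafVolume p := by
  have h := AlternatingMap.eq_smul_basis_det (EuclideanSpace.basisFun (Fin p) ℝ).toBasis
    ((leafVolume p).compContinuousLinearMap L).toAlternatingMap
  ext v
  have := DFunLike.congr_fun h v
  rw [OrthonormalBasis.coe_toBasis] at this
  exact this

theorem contDiff_leafVolume_comp :
    ContDiff ℝ ∞ fun L : EuclideanSpace ℝ (Fin p) →L[ℝ] EuclideanSpace ℝ (Fin p) =>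
      (leafVolume p).compContinuousLinearMap L := by
  simp only [leafVolume_comp]
  have h : ContDiff ℝ ∞ fun (L : EuclideanSpace ℝ (Fin p) →L[ℝ] EuclideanSpace ℝ (Fin p))
      (i : Fin p) => L (EuclideanSpace.basisFun (Fin p) ℝ i) :=
    contDiff_pi.2 fun i => contDiff_id.clm_apply contDiff_const
  exact ((ContinuousMultilinearMap.contDiff
    (leafVolume p).toContinuousMultilinearMap).comp h).smul contDiff_const

/-- There are no nonzero forms of degree `p + 1` on `ℝ^p`. -/
theorem eq_zero_of_degree_gt (β : EuclideanSpace ℝ (Fin p) [⋀^Fin (p + 1)]→L[ℝ] ℝ) : β = 0 := by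
  ext v
  refine AlternatingMap.map_linearDependent β.toAlternatingMap v fun h => ?_
  have := h.fintype_card_le_finrank
  simp at this

end Volume

/-! ### Extension by zero of top forms given in one chart -/

section TopForms

variable {p q : ℕ} {r : ℕ∞} {X : Type*} [TopologicalSpace X] [ChartedSpace (FoliationModel p q) X]

/-- The leafwise `p`-form that is `a dx¹ ∧ ⋯ ∧ dx^p` in the chart `φ`, extended by `0`. -/
noncomputable def volumeExtension (φ : FoliationChart p q r X) :
    (FoliationModel p q → ℝ) →ₗ[ℝ] FormFamily p q r X p where
  toFun a ψ := (ψ.1.symm ≫ₕ φ.1).source.indicator fun z => a (φ.1 (ψ.1.symm z)) •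
    (leafVolume p).compContinuousLinearMap (leafDeriv (fun w => (φ.1 (ψ.1.symm w)).1) z)
  map_add' a b := by
    funext ψ z
    refine Eq.trans ?_ (FormFamily.add_apply _ _ ψ z).symm
    by_cases hz : z ∈ (ψ.1.symm ≫ₕ φ.1).source
    · simp only [Set.indicator_of_mem hz, Pi.add_apply, add_smul]
    · simp only [Set.indicator_of_notMem hz, add_zero]
  map_smul' c a := by
    funext ψ z
    refine Eq.trans ?_ (FormFamily.smul_apply c _ ψ z).symm
    by_cases hz : z ∈ (ψ.1.symm ≫ₕ φ.1).source
    · simp only [Set.indicator_of_mem hz, Pi.smul_apply, smul_assoc]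
    · simp only [Set.indicator_of_notMem hz, smul_zero]

theorem volumeExtension_apply (φ ψ : FoliationChart p q r X) (a : FoliationModel p q → ℝ)
    {z : FoliationModel p q} (hz : z ∈ (ψ.1.symm ≫ₕ φ.1).source) :
    volumeExtension φ a ψ z = a (φ.1 (ψ.1.symm z)) •
      (leafVolume p).compContinuousLinearMap (leafDeriv (fun w => (φ.1 (ψ.1.symm w)).1) z) :=
  Set.indicator_of_mem hz fun z => a (φ.1 (ψ.1.symm z)) •
    (leafVolume p).compContinuousLinearMap (leafDeriv (fun w => (φ.1 (ψ.1.symm w)).1) z)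

theorem volumeExtension_apply_of_notMem (φ ψ : FoliationChart p q r X) (a : FoliationModel p q → ℝ)
    {z : FoliationModel p q} (hz : z ∉ (ψ.1.symm ≫ₕ φ.1).source) : volumeExtension φ a ψ z = 0 :=
  Set.indicator_of_notMem hz fun z => a (φ.1 (ψ.1.symm z)) •
    (leafVolume p).compContinuousLinearMap (leafDeriv (fun w => (φ.1 (ψ.1.symm w)).1) z)

theorem volumeExtension_self (φ : FoliationChart p q r X) (a : FoliationModel p q → ℝ)
    {z : FoliationModel p q} (hz : z ∈ φ.1.target) :
    volumeExtension φ a φ z = a z • leafVolume p := by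
  have hev : (fun w => (φ.1 (φ.1.symm w)).1) =ᶠ[𝓝 z] fun w => w.1 := by
    filter_upwards [φ.1.open_target.mem_nhds hz] with w hw
    rw [φ.1.right_inv hw]
  rw [volumeExtension_apply φ φ a ⟨hz, φ.1.map_target hz⟩, φ.1.right_inv hz, leafDeriv_congr hev]
  have : leafDeriv (fun w : FoliationModel p q => w.1) z = ContinuousLinearMap.id ℝ _ :=
    fderiv_fun_id
  rw [this]
  rfl

/-- The image of any chart `ψ` is covered by two open sets: the overlap with `φ`, where the form is
a pullback with smooth data, and the part lying over the complement of `C`, where it vanishes. They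
cover because `C` is inside the domain of `φ`. -/
theorem volumeExtension_mem (φ : FoliationChart p q r X) {a : FoliationModel p q → ℝ}
    (ha : LeafwiseSmoothOn r a φ.1.target) {C : Set X} (hC : IsClosed C) (hCφ : C ⊆ φ.1.source)
    (haC : ∀ m ∈ φ.1.source, m ∉ C → a (φ.1 m) = 0) :
    volumeExtension φ a ∈ leafwiseForms p q r X p := by
  refine ⟨fun ψ => leafwiseSmoothOn_of_locally fun z hz => ?_, fun ψ z hz => ?_,
    fun ψ₁ ψ₂ z hz => ?_⟩
  · by_cases hzφ : z ∈ (ψ.1.symm ≫ₕ φ.1).source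
    · have ho := (ψ.1.symm ≫ₕ φ.1).open_source
      have hτ := FoliationChart.isFoliatedOn_transition ψ φ
      refine ⟨_, ho, hzφ, ?_⟩
      have h1 : LeafwiseSmoothOn r (fun z => a (φ.1 (ψ.1.symm z))) (ψ.1.symm ≫ₕ φ.1).source :=
        hτ.comp_leafwise ho φ.1.open_target ha fun w hw => φ.1.map_source hw.2
      have h2 := (hτ.leafwise.leafDeriv ho).contDiff_comp ho contDiff_leafVolume_comp
      exact (h1.bilin ho (ContinuousLinearMap.lsmul ℝ ℝ) h2).congr ho fun w hw =>
        volumeExtension_apply φ ψ a hw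
    · have ho : IsOpen (ψ.1.target ∩ ψ.1.symm ⁻¹' Cᶜ) :=
        ψ.1.isOpen_inter_preimage_symm hC.isOpen_compl
      refine ⟨_, ho, ⟨hz, fun h => hzφ ⟨hz, hCφ h⟩⟩, ?_⟩
      refine (leafwiseSmoothOn_of_contDiffOn (f := fun _ => 0) ho contDiffOn_const).congr ho
        fun w hw => ?_
      by_cases hwφ : w ∈ (ψ.1.symm ≫ₕ φ.1).source
      · rw [volumeExtension_apply φ ψ a hwφ, haC _ ((FoliationChart.mem_transition_source ψ φ).1 hwφ).2 hw.2,
          zero_smul]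
      · exact volumeExtension_apply_of_notMem φ ψ a hwφ
  · exact volumeExtension_apply_of_notMem φ ψ a fun h => hz h.1
  · have hzs : ψ₁.1.symm z ∈ ψ₂.1.source := hz.2
    by_cases hzφ : z ∈ (ψ₁.1.symm ≫ₕ φ.1).source
    · have hz₂ : ψ₂.1 (ψ₁.1.symm z) ∈ (ψ₂.1.symm ≫ₕ φ.1).source := by
        refine (FoliationChart.mem_transition_source ψ₂ φ).2 ⟨ψ₂.1.map_source hzs, ?_⟩
        rw [ψ₂.1.left_inv hzs]
        exact hzφ.2
      rw [volumeExtension_apply φ ψ₁ a hzφ, volumeExtension_apply φ ψ₂ a hz₂, ψ₂.1.left_inv hzs]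
      -- Near `z` the transition from `ψ₁` to `φ` factors through `ψ₂`, so compatibility is the
      -- functoriality of pullback, i.e. the chain rule.
      have hev : (fun w => (φ.1 (ψ₁.1.symm w)).1) =ᶠ[𝓝 z]
          fun w => (φ.1 (ψ₂.1.symm (ψ₂.1 (ψ₁.1.symm w)))).1 := by
        filter_upwards [(ψ₁.1.symm ≫ₕ ψ₂.1).open_source.mem_nhds hz] with w hw
        rw [ψ₂.1.left_inv ((FoliationChart.mem_transition_source ψ₁ ψ₂).1 hw).2]
      rw [leafDeriv_congr hev, (FoliationChart.isFoliatedOn_transition ψ₁ ψ₂).leafDeriv_comp hz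
        (f := fun w => (φ.1 (ψ₂.1.symm w)).1)
        ((FoliationChart.isFoliatedOn_transition ψ₂ φ).leafwise.differentiableAt hz₂)]
      rfl
    · have hz₂ : ψ₂.1 (ψ₁.1.symm z) ∉ (ψ₂.1.symm ≫ₕ φ.1).source := by
        intro h
        have h' := ((FoliationChart.mem_transition_source ψ₂ φ).1 h).2
        rw [ψ₂.1.left_inv hzs] at h'
        exact hzφ ⟨hz.1, h'⟩
      rw [volumeExtension_apply_of_notMem φ ψ₁ a hzφ, volumeExtension_apply_of_notMem φ ψ₂ a hz₂]
      rfl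

theorem leafwiseD_top (α : leafwiseForms p q r X p) : leafwiseD p q r X p α = 0 := by
  ext1
  funext ψ z
  exact eq_zero_of_degree_gt _

end TopForms

/-! ### Restriction of charts to an open subset -/

section Restriction

variable {H M : Type*} [TopologicalSpace H] [TopologicalSpace M] [ChartedSpace H M]

/-- The transition between two restricted charts is the restriction to an open set of the original
transition, hence stays in a groupoid closed under restriction. -/
theorem subtypeRestr_mem_maximalAtlas_of_mem_maximalAtlas (G : StructureGroupoid H)
    [HasGroupoid M G] [ClosedUnderRestriction G] {e : OpenPartialHomeomorph M H}
    (he : e ∈ G.maximalAtlas M) {s : TopologicalSpace.Opens M} (hs : Nonempty s) :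
    e.subtypeRestr hs ∈ G.maximalAtlas s := by
  intro e' he'
  obtain ⟨x, rfl⟩ := TopologicalSpace.Opens.chart_eq hs he'
  have key : ∀ {e₁ e₂ : OpenPartialHomeomorph M H}, e₁ ∈ G.maximalAtlas M →
      e₂ ∈ G.maximalAtlas M → (e₁.subtypeRestr hs).symm ≫ₕ e₂.subtypeRestr hs ∈ G := by
    intro e₁ e₂ h₁ h₂
    refine G.mem_of_eqOnSource ?_ (e₁.subtypeRestr_symm_trans_subtypeRestr hs e₂)
    exact closedUnderRestriction' (G.compatible_of_mem_maximalAtlas h₁ h₂)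
      (e₁.isOpen_inter_preimage_symm s.2)
  exact ⟨key he (G.chart_mem_maximalAtlas _), key (G.chart_mem_maximalAtlas _) he⟩

end Restriction

/-! ### Exact forms have bounded integrals along the plaques -/

section BoundedPairing

open MeasureTheory

/-- Outside `s` the values of `g` are arbitrary, but there `χ` vanishes in a neighborhood of each
point. This is what makes integrals over all of `V` meaningful for functions defined only on part of
a plaque. -/
theorem continuous_mul_of_tsupport_subset {Y : Type*} [TopologicalSpace Y] {χ g : Y → ℝ}
    (hχ : Continuous χ) {s : Set Y} (hs : IsOpen s) (hg : ContinuousOn g s) (hsub : tsupport χ ⊆ s) :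
    Continuous fun x => χ x * g x :=
  (hχ.continuousOn.mul hg).continuous_of_tsupport_subset hs
    ((tsupport_mul_subset_left (f := χ) (g := g)).trans hsub)

variable {V W : Type} [NormedAddCommGroup V] [NormedSpace ℝ V] [FiniteDimensional ℝ V]
  [MeasurableSpace V] [BorelSpace V] {μ : Measure V} [μ.IsAddHaarMeasure]
  [NormedAddCommGroup W] [NormedSpace ℝ W] {r : ℕ∞}

/-- Integrals of leafwise derivatives against a cutoff function `χ` stay bounded along a convergent
sequence of plaques if the function is defined on the limit of the support of `dχ`. -/
theorem exists_bound_integral_mul_leafDeriv {T : Set (V × W)} (hT : IsOpen T) {f : V × W → ℝ}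
    (hf : LeafwiseSmoothOn r f T) {χ : V → ℝ} (hχ : ContDiff ℝ ∞ χ) (hχc : HasCompactSupport χ)
    {y : ℕ → W} {y₀ : W} (hy : Filter.Tendsto y Filter.atTop (𝓝 y₀))
    (hyT : ∀ i, ∀ x ∈ tsupport χ, (x, y i) ∈ T) (h0T : ∀ x ∈ tsupport (fderiv ℝ χ), (x, y₀) ∈ T)
    (v : V) :
    ∃ B, ∀ i, ‖∫ x, χ x * leafDeriv f (x, y i) v ∂μ‖ ≤ B := by
  have hχ' : Continuous fun x => fderiv ℝ χ x v :=
    (hχ.continuous_fderiv (by simp)).clm_apply continuous_const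
  have hχ'c : HasCompactSupport fun x => fderiv ℝ χ x v := hχc.fderiv_apply ℝ v
  have hsupp : tsupport (fun x => fderiv ℝ χ x v) ⊆ tsupport (fderiv ℝ χ) :=
    closure_mono fun x hx h => hx (by simp [h])
  -- Adding the limit `y₀` makes the set of parameters compact. On the limit plaque only the support
  -- of `dχ` has to lie in `T`, not that of `χ`.
  have hD : IsCompact (tsupport (fderiv ℝ χ) ×ˢ insert y₀ (Set.range y)) :=
    (hχc.fderiv ℝ).isCompact.prod hy.isCompact_insert_range
  have hDT : tsupport (fderiv ℝ χ) ×ˢ insert y₀ (Set.range y) ⊆ T := by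
    rintro ⟨x, w⟩ ⟨hx, rfl | ⟨i, rfl⟩⟩
    · exact h0T x hx
    · exact hyT i x (tsupport_fderiv_subset ℝ hx)
  obtain ⟨C, hC⟩ := hD.exists_bound_of_continuousOn ((hf.continuousOn hT).mono hDT)
  refine ⟨∫ x, ‖fderiv ℝ χ x v‖ * C ∂μ, fun i => ?_⟩
  have hs : IsOpen {x | (x, y i) ∈ T} := hT.preimage (Continuous.prodMk_left (y i))
  have hsub : tsupport χ ⊆ {x | (x, y i) ∈ T} := hyT i
  have hfd : ContDiffOn ℝ ∞ (fun x => f (x, y i)) {x | (x, y i) ∈ T} := fun x hx =>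
    (hf.smooth (x, y i) hx).contDiffWithinAt
  have hf' : ContinuousOn (fun x => fderiv ℝ (fun x => f (x, y i)) x v) {x | (x, y i) ∈ T} :=
    (hfd.continuousOn_fderiv_of_isOpen hs (by simp)).clm_apply continuousOn_const
  -- The compact support of `χ` leaves no boundary term.
  have hparts := integral_mul_fderiv_eq_neg_fderiv_mul_of_integrable (μ := μ) (f := χ)
    (g := fun x => f (x, y i)) (v := v)
    ((continuous_mul_of_tsupport_subset hχ' hs hfd.continuousOn
      ((hsupp.trans (tsupport_fderiv_subset ℝ)).trans hsub)).integrable_of_hasCompactSupport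
        hχ'c.mul_right)
    ((continuous_mul_of_tsupport_subset hχ.continuous hs hf' hsub).integrable_of_hasCompactSupport
      hχc.mul_right)
    ((continuous_mul_of_tsupport_subset hχ.continuous hs
      hfd.continuousOn hsub).integrable_of_hasCompactSupport hχc.mul_right)
    (fun x _ => (hχ.differentiable (by simp)).differentiableAt)
    fun x hx => hf.differentiableAt (z := (x, y i)) (hyT i x hx)
  change ‖∫ x, χ x * fderiv ℝ (fun x => f (x, y i)) x v ∂μ‖ ≤ _
  rw [hparts, norm_neg]
  refine norm_integral_le_of_norm_le
    ((hχ'.norm.integrable_of_hasCompactSupport hχ'c.norm).mul_const C) (ae_of_all _ fun x => ?_)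
  rw [norm_mul]
  by_cases hx : x ∈ tsupport (fderiv ℝ χ)
  · exact mul_le_mul_of_nonneg_left (hC (x, y i) ⟨hx, Or.inr ⟨i, rfl⟩⟩) (norm_nonneg _)
  · simp [image_eq_zero_of_notMem_tsupport hx]

end BoundedPairing

section ExactForms

open MeasureTheory

variable {p q k : ℕ} {r : ℕ∞}

/-- On fixed vectors `e`, the exterior derivative is an alternating sum of directional derivatives
along `e j` of the functions obtained by inserting the remaining vectors into `η`. The bounds for
these summands add up. -/
theorem exists_bound_integral_mul_leafExtDeriv {T : Set (FoliationModel p q)} (hT : IsOpen T)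
    {η : FoliationModel p q → EuclideanSpace ℝ (Fin p) [⋀^Fin k]→L[ℝ] ℝ}
    (hη : LeafwiseSmoothOn r η T) {χ : EuclideanSpace ℝ (Fin p) → ℝ} (hχ : ContDiff ℝ ∞ χ)
    (hχc : HasCompactSupport χ) {y : ℕ → EuclideanSpace ℝ (Fin q)} {y₀ : EuclideanSpace ℝ (Fin q)}
    (hy : Filter.Tendsto y Filter.atTop (𝓝 y₀)) (hyT : ∀ i, ∀ x ∈ tsupport χ, (x, y i) ∈ T)
    (h0T : ∀ x ∈ tsupport (fderiv ℝ χ), (x, y₀) ∈ T)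
    (e : Fin (k + 1) → EuclideanSpace ℝ (Fin p)) :
    ∃ B, ∀ i, ‖∫ x, χ x * leafExtDeriv η (x, y i) e‖ ≤ B := by
  have hf : ∀ j : Fin (k + 1), LeafwiseSmoothOn r (fun z => η z (j.removeNth e)) T := fun j =>
    hη.clm hT (ContinuousAlternatingMap.apply ℝ (EuclideanSpace ℝ (Fin p)) ℝ (j.removeNth e))
  choose B hB using fun j => exists_bound_integral_mul_leafDeriv (μ := volume) hT (hf j) hχ hχc hy
    hyT h0T (e j)
  refine ⟨∑ j, B j, fun i => ?_⟩
  have hs : IsOpen {x | (x, y i) ∈ T} := hT.preimage (Continuous.prodMk_left (y i))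
  have hint : ∀ j : Fin (k + 1), Integrable fun x =>
      χ x * leafDeriv (fun z => η z (j.removeNth e)) (x, y i) (e j) := by
    intro j
    refine Continuous.integrable_of_hasCompactSupport
      (continuous_mul_of_tsupport_subset hχ.continuous hs ?_ (hyT i)) hχc.mul_right
    have h1 : ContDiffOn ℝ ∞ (fun x => η (x, y i) (j.removeNth e)) {x | (x, y i) ∈ T} :=
      fun x hx => ((hf j).smooth (x, y i) hx).contDiffWithinAt
    exact (h1.continuousOn_fderiv_of_isOpen hs (by simp)).clm_apply continuousOn_const
  have hexp : ∀ x, χ x * leafExtDeriv η (x, y i) e = ∑ j : Fin (k + 1),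
      (-1) ^ (j : ℕ) * (χ x * leafDeriv (fun z => η z (j.removeNth e)) (x, y i) (e j)) := by
    intro x
    by_cases hx : x ∈ tsupport χ
    · rw [leafExtDeriv, extDeriv_apply (hη.differentiableAt (z := (x, y i)) (hyT i x hx)),
        Finset.mul_sum]
      refine Finset.sum_congr rfl fun j _ => ?_
      rw [zsmul_eq_mul]
      push_cast
      exact mul_left_comm _ _ _
    · simp [image_eq_zero_of_notMem_tsupport hx]
  simp only [hexp]
  rw [integral_finsetSum _ fun j _ => (hint j).const_mul _]
  refine (norm_sum_le _ _).trans (Finset.sum_le_sum fun j _ => ?_)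
  rw [integral_const_mul, norm_mul, norm_pow, norm_neg, norm_one, one_pow, one_mul]
  exact hB j i

/-- The pairing of an exact top degree form with a cutoff function on a convergent sequence of
plaques is bounded. -/
theorem exists_bound_of_mem_exactForms {X : Type*} [TopologicalSpace X]
    [ChartedSpace (FoliationModel p q) X] (φ : FoliationChart p q r X)
    {α : leafwiseForms p q r X p} (hα : α ∈ exactForms p q r X p)
    {χ : EuclideanSpace ℝ (Fin p) → ℝ} (hχ : ContDiff ℝ ∞ χ)
    (hχc : HasCompactSupport χ) {y : ℕ → EuclideanSpace ℝ (Fin q)} {y₀ : EuclideanSpace ℝ (Fin q)}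
    (hy : Filter.Tendsto y Filter.atTop (𝓝 y₀))
    (hyT : ∀ i, ∀ x ∈ tsupport χ, (x, y i) ∈ φ.1.target)
    (h0T : ∀ x ∈ tsupport (fderiv ℝ χ), (x, y₀) ∈ φ.1.target)
    (e : Fin p → EuclideanSpace ℝ (Fin p)) :
    ∃ B, ∀ i, ‖∫ x, χ x * α.1 φ (x, y i) e‖ ≤ B := by
  cases p with
  | zero =>
    have h0 : α = 0 := hα
    refine ⟨0, fun i => ?_⟩
    subst h0
    have : ∀ z, (0 : leafwiseForms 0 q r X 0).1 φ z = 0 := fun z => rfl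
    simp [this]
  | succ k =>
    obtain ⟨η, rfl⟩ := hα
    obtain ⟨B, hB⟩ := exists_bound_integral_mul_leafExtDeriv φ.1.open_target (η.2.1 φ) hχ hχc hy
      hyT h0T e
    refine ⟨B, fun i => ?_⟩
    convert hB i using 4 with x
    -- Off the support of `χ` the plaque may leave the chart image, where the derivative of `η` is
    -- set to `0`; the factor `χ x = 0` makes both sides agree.
    by_cases hx : x ∈ tsupport χ
    · congr 2
      exact Set.indicator_of_mem (hyT i x hx) _
    · simp [image_eq_zero_of_notMem_tsupport hx]

end ExactForms

/-! ### Divergence of the integrals of the singular forms -/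

section Unbounded

open MeasureTheory Filter

/-- The factor `X ^ (N + 1)` gives the product degree greater than `N` even for constant `P`. The
difference with `X ^ N` thus keeps the positive leading coefficient, tends to infinity, and is
bounded below on `[0, ∞)`. -/
theorem exists_pow_sub_le_eval {P : Polynomial ℝ} (hP : 0 < P.leadingCoeff) (N : ℕ) :
    ∃ C, 0 ≤ C ∧ ∀ t, 0 ≤ t → t ^ N - C ≤ (P * Polynomial.X ^ (N + 1)).eval t := by
  set Q := P * Polynomial.X ^ (N + 1) - Polynomial.X ^ N with hQ
  have hP0 : P ≠ 0 := by rintro rfl; simp at hP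
  have hdeg : (Polynomial.X ^ N : Polynomial ℝ).degree <
      (P * Polynomial.X ^ (N + 1)).degree := by
    rw [Polynomial.degree_mul, Polynomial.degree_X_pow, Polynomial.degree_X_pow,
      Polynomial.degree_eq_natDegree hP0]
    exact_mod_cast (by omega : N < P.natDegree + (N + 1))
  have hlead : Q.leadingCoeff = P.leadingCoeff := by
    rw [hQ, Polynomial.leadingCoeff_sub_of_degree_lt hdeg, Polynomial.leadingCoeff_mul]
    simp
  have hQdeg : 0 < Q.degree := by
    rw [hQ, Polynomial.degree_sub_eq_left_of_degree_lt hdeg]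
    refine lt_of_le_of_lt ?_ hdeg
    rw [Polynomial.degree_X_pow]
    exact_mod_cast Nat.zero_le N
  have hlim := Q.tendsto_atTop_of_leadingCoeff_nonneg hQdeg (hlead ▸ hP.le)
  obtain ⟨R, hR⟩ := (hlim.eventually_ge_atTop 0).exists_forall_of_atTop
  obtain ⟨C, hC⟩ := (isCompact_Icc (a := (0 : ℝ)) (b := R)).exists_bound_of_continuousOn
    Q.continuous.continuousOn
  refine ⟨max C 0, le_max_right _ _, fun t ht => ?_⟩
  have key : -max C 0 ≤ Q.eval t := by
    rcases le_total R t with h | h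
    · exact (neg_nonpos.2 (le_max_right _ _)).trans (hR t h)
    · exact (neg_le_neg ((hC t ⟨ht, h⟩).trans (le_max_left _ _))).trans (neg_abs_le _)
  simp only [hQ, Polynomial.eval_sub, Polynomial.eval_pow, Polynomial.eval_X] at key
  linarith

variable {V W : Type*} [NormedAddCommGroup V] [NormedSpace ℝ V] [FiniteDimensional ℝ V]
  [MeasurableSpace V] [BorelSpace V] {μ : Measure V} [μ.IsAddHaarMeasure]
  [NormedAddCommGroup W]

/-- The inverse square distance to the origin of `V × W`, for the Euclidean distance. -/
noncomputable def invSqDist (z : V × W) : ℝ := (‖z.1‖ ^ 2 + ‖z.2‖ ^ 2)⁻¹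

/-- With `n = dim V` and `ε = ‖y i‖`, the inverse square distance is at least `1 / (2ε²)` on the
ball `‖x‖ ≤ ε`, whose volume is `c εⁿ`. Its power `n + 1` contributes at least a constant times
`ε^(-(n+2))` there, while the lower order error costs at most `C μ(U)`. -/
theorem tendsto_integral_mul_eval_invSqDist {u : V × W → ℝ} (hu : Continuous u)
    (hu0 : ∀ z, 0 ≤ u z) (hu1 : ∀ z, u z ≤ 1) {U : Set V} (hU : IsCompact U)
    (huU : ∀ z : V × W, z.1 ∉ U → u z = 0) (hu_one : ∀ᶠ z in 𝓝 0, u z = 1)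
    {y : ℕ → W} (hy : Tendsto y atTop (𝓝 0)) (hy0 : ∀ i, y i ≠ 0)
    {P : Polynomial ℝ} (hP : 0 < P.leadingCoeff) :
    Tendsto (fun i => ∫ x, u (x, y i) *
      (P * Polynomial.X ^ (Module.finrank ℝ V + 1 + 1)).eval (invSqDist (x, y i)) ∂μ)
      atTop atTop := by
  set n := Module.finrank ℝ V with hn
  obtain ⟨C, hC0, hC⟩ := exists_pow_sub_le_eval hP (n + 1)
  obtain ⟨δ, hδ, hball⟩ := Metric.eventually_nhds_iff_ball.1 hu_one
  set c := μ.real (Metric.ball (0 : V) 1) with hc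
  have hcpos : 0 < c :=
    ENNReal.toReal_pos (Metric.measure_ball_pos μ 0 one_pos).ne' measure_ball_lt_top.ne
  have hnorm : Tendsto (fun i => ‖y i‖) atTop (𝓝[>] 0) := by
    refine tendsto_nhdsWithin_iff.2 ⟨by simpa using hy.norm, ?_⟩
    exact Eventually.of_forall fun i => norm_pos_iff.2 (hy0 i)
  have hpow : Tendsto (fun i => (‖y i‖ ^ (n + 2))⁻¹) atTop atTop := by
    refine tendsto_inv_nhdsGT_zero.comp (tendsto_nhdsWithin_iff.2 ⟨?_, ?_⟩)
    · simpa using (tendsto_nhdsWithin_iff.1 hnorm).1.pow (n + 2)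
    · exact Eventually.of_forall fun i => pow_pos (norm_pos_iff.2 (hy0 i)) _
  have hlow : Tendsto (fun i => (2 ^ (n + 1))⁻¹ * c * (‖y i‖ ^ (n + 2))⁻¹ - C * μ.real U)
      atTop atTop :=
    tendsto_atTop_add_const_right _ _ (hpow.const_mul_atTop (by positivity))
  refine tendsto_atTop_mono' _ ?_ hlow
  have hsmall : ∀ᶠ i in atTop, ‖y i‖ < δ :=
    (tendsto_nhdsWithin_iff.1 hnorm).1.eventually_lt_const hδ
  filter_upwards [hsmall] with i hi
  have hε : 0 < ‖y i‖ := norm_pos_iff.2 (hy0 i)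
  set ε := ‖y i‖ with hεdef
  have hs : Continuous fun x : V => invSqDist (x, y i) := by
    unfold invSqDist
    refine Continuous.inv₀ (by fun_prop) fun x => ?_
    have : 0 < ‖y i‖ ^ 2 := pow_pos hε 2
    positivity
  have hint : Integrable (fun x => u (x, y i) *
      (P * Polynomial.X ^ (n + 1 + 1)).eval (invSqDist (x, y i))) μ := by
    refine Continuous.integrable_of_hasCompactSupport ?_ ?_
    · exact (hu.comp (Continuous.prodMk_left (y i))).mul ((Polynomial.continuous _).comp hs)
    · exact HasCompactSupport.intro hU fun x hx => by simp [huU (x, y i) hx]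
  have hball_vol : μ.real (Metric.closedBall (0 : V) ε) = ε ^ n * c := by
    rw [Measure.real, Measure.addHaar_closedBall μ 0 hε.le, ENNReal.toReal_mul,
      ENNReal.toReal_ofReal (by positivity)]
    rfl
  have hmeasB : MeasurableSet (Metric.closedBall (0 : V) ε) := measurableSet_closedBall
  have hfinB : μ (Metric.closedBall (0 : V) ε) ≠ ⊤ := measure_closedBall_lt_top.ne
  have hfinU : μ U ≠ ⊤ := hU.measure_lt_top.ne
  -- The comparison function is the minimum of the main term on the ball, minus the error `C` on all
  -- of `U`; its integral is the diverging lower bound.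
  have hlowint : Integrable (fun x =>
      (Metric.closedBall (0 : V) ε).indicator (fun _ => ((2 * ε ^ 2)⁻¹) ^ (n + 1)) x -
        U.indicator (fun _ => C) x) μ :=
    ((integrable_indicator_iff hmeasB).2 (integrableOn_const hfinB)).sub
      ((integrable_indicator_iff hU.measurableSet).2 (integrableOn_const hfinU))
  have hval : ∫ x, ((Metric.closedBall (0 : V) ε).indicator
      (fun _ => ((2 * ε ^ 2)⁻¹) ^ (n + 1)) x - U.indicator (fun _ => C) x) ∂μ =
      (2 ^ (n + 1))⁻¹ * c * (ε ^ (n + 2))⁻¹ - C * μ.real U := by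
    rw [integral_sub ((integrable_indicator_iff hmeasB).2 (integrableOn_const hfinB))
      ((integrable_indicator_iff hU.measurableSet).2 (integrableOn_const hfinU)),
      integral_indicator hmeasB, integral_indicator hU.measurableSet, setIntegral_const,
      setIntegral_const, hball_vol, smul_eq_mul, smul_eq_mul, mul_comm C]
    congr 1
    rw [inv_pow, mul_pow, ← pow_mul, mul_inv]
    field_simp
    ring
  rw [← hval]
  refine integral_mono hlowint hint fun x => ?_
  have hspos : 0 ≤ invSqDist (x, y i) := by unfold invSqDist; positivity
  have hQ := hC _ hspos
  have h1 : u (x, y i) * (invSqDist (x, y i) ^ (n + 1) - C) ≤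
      u (x, y i) * (P * Polynomial.X ^ (n + 1 + 1)).eval (invSqDist (x, y i)) :=
    mul_le_mul_of_nonneg_left hQ (hu0 _)
  refine le_trans ?_ h1
  rw [mul_sub]
  refine sub_le_sub ?_ ?_
  · by_cases hx : x ∈ Metric.closedBall (0 : V) ε
    · rw [Set.indicator_of_mem hx]
      have hx' : ‖x‖ ≤ ε := by simpa using hx
      have hux : u (x, y i) = 1 := by
        refine hball _ ?_
        rw [mem_ball_zero_iff, Prod.norm_def]
        exact max_lt (hx'.trans_lt hi) hi
      rw [hux, one_mul]
      refine pow_le_pow_left₀ (by positivity) ?_ _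
      unfold invSqDist
      refine inv_anti₀ (by positivity) ?_
      have : ‖x‖ ^ 2 ≤ ε ^ 2 := pow_le_pow_left₀ (norm_nonneg _) hx' 2
      linarith
    · rw [Set.indicator_of_notMem hx]
      exact mul_nonneg (hu0 _) (pow_nonneg hspos _)
  · by_cases hx : x ∈ U
    · rw [Set.indicator_of_mem hx]
      exact mul_le_of_le_one_left hC0 (hu1 _)
    · rw [Set.indicator_of_notMem hx, huU _ hx, zero_mul]

end Unbounded

/-! ### Coefficients with a singularity at the origin -/

section SingularForms

theorem contDiffAt_eval_invSqDist {V W : Type*} [NormedAddCommGroup V] [InnerProductSpace ℝ V]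
    [NormedAddCommGroup W] [InnerProductSpace ℝ W] (Q : Polynomial ℝ) {z : V × W} (hz : z ≠ 0) :
    ContDiffAt ℝ ∞ (fun z : V × W => Q.eval (invSqDist z)) z := by
  have h : ContDiffAt ℝ ∞ (fun z : V × W => invSqDist z) z := by
    unfold invSqDist
    refine ContDiffAt.inv ?_ ?_
    · exact (contDiff_fst.norm_sq ℝ |>.add (contDiff_snd.norm_sq ℝ)).contDiffAt
    · intro h0
      have h1 : ‖z.1‖ = 0 := by nlinarith [sq_nonneg ‖z.1‖, sq_nonneg ‖z.2‖]
      have h2 : ‖z.2‖ = 0 := by nlinarith [sq_nonneg ‖z.1‖, sq_nonneg ‖z.2‖]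
      exact hz (Prod.ext (norm_eq_zero.1 h1) (norm_eq_zero.1 h2))
  have hQ : ContDiff ℝ ∞ fun t : ℝ => Q.eval t := by
    simpa only [Polynomial.coe_aeval_eq_eval] using Q.contDiff_aeval (𝕜 := ℝ) ∞
  exact hQ.contDiffAt.comp z h

variable {V W : Type*} [NormedAddCommGroup V] [NormedAddCommGroup W]

/-- The functions on `V × W` that are polynomial in the inverse square distance to the origin,
multiplied by a power of that and by a cutoff function. -/
noncomputable def singularCoeff (h : V × W → ℝ) (N : ℕ) : Polynomial ℝ →ₗ[ℝ] (V × W → ℝ) where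
  toFun P z := h z * (P * Polynomial.X ^ N).eval (invSqDist z)
  map_add' P Q := by
    funext z
    simp only [Pi.add_apply, add_mul, Polynomial.eval_add, mul_add]
  map_smul' c P := by
    funext z
    simp only [Pi.smul_apply, RingHom.id_apply, smul_eq_mul, Polynomial.smul_eq_C_mul, mul_assoc,
      Polynomial.eval_mul, Polynomial.eval_C]
    ring

end SingularForms

/-! ### Smooth cutoff functions -/

section Cutoff

variable {V : Type*} [NormedAddCommGroup V] [NormedSpace ℝ V]

theorem exists_contDiff_cutoff [FiniteDimensional ℝ V] {A U : Set V} (hA : IsClosed A)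
    (hU : IsCompact U) (hAU : A ⊆ interior U) :
    ∃ χ : V → ℝ, ContDiff ℝ ∞ χ ∧ tsupport χ ⊆ U ∧ HasCompactSupport χ ∧
      (∀ x, χ x ∈ Set.Icc 0 1) ∧ ∀ᶠ x in 𝓝ˢ A, χ x = 1 := by
  obtain ⟨χ, h1, h0, hχ⟩ := exists_contMDiffMap_one_nhds_of_subset_interior (n := ⊤)
    (modelWithCornersSelf ℝ V) hA hAU
  have hsub : tsupport χ ⊆ U := closure_minimal (fun x hx => by
    by_contra hxU
    exact hx (h0 x hxU)) hU.isClosed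
  exact ⟨χ, χ.contMDiff.contDiff, hsub, hU.of_isClosed_subset (isClosed_tsupport _) hsub, hχ, h1⟩

theorem notMem_tsupport_fderiv_of_eventually_eq_const {χ : V → ℝ} {A : Set V} {c : ℝ}
    (h : ∀ᶠ x in 𝓝ˢ A, χ x = c) {x : V} (hx : x ∈ A) : x ∉ tsupport (fderiv ℝ χ) := by
  rw [notMem_tsupport_iff_eventuallyEq]
  have hev : ∀ᶠ w in 𝓝 x, χ w = c := h.filter_mono (nhds_le_nhdsSet hx)
  filter_upwards [hev.eventually_nhds] with w hw
  rw [Filter.EventuallyEq.fderiv_eq (f₁ := χ) (f := fun _ => c) hw]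
  simp

end Cutoff

end LeafwiseDeRham

/-! ### Infinitely many independent classes in top degree -/

theorem proposition2p1 (p q : ℕ) (r : ℕ∞) (M : Type*) [TopologicalSpace M] [T2Space M]
    [ChartedSpace (FoliationModel p q) M] [HasGroupoid M (foliationGroupoid p q r)]
    (K : Set M) (hK : IsClosed K)
    -- a foliation chart, identified with all of `ℝ^p × ℝ^q`
    (φ : OpenPartialHomeomorph M (FoliationModel p q))
    (hφ : φ ∈ (foliationGroupoid p q r).maximalAtlas M) (hφ_univ : φ.target = Set.univ)
    (h_zero : φ.symm (0, 0) ∈ K)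
    (U : Set (EuclideanSpace ℝ (Fin p))) (hU_compact : IsCompact U) (hU_nhds : U ∈ 𝓝 0)
    (hU_smooth : HasSmoothBoundary U) (hU_frontier : ∀ x ∈ frontier U, φ.symm (x, 0) ∉ K)
    (y : ℕ → EuclideanSpace ℝ (Fin q)) (hy : Filter.Tendsto y Filter.atTop (𝓝 0))
    (hyK : ∀ i, ∀ x ∈ U, φ.symm (x, y i) ∉ K) :
    -- the foliation induced on the open subset `M ∖ K`
    ¬ FiniteDimensional ℝ
      (LeafwiseCohomology p q r (⟨Kᶜ, hK.isOpen_compl⟩ : TopologicalSpace.Opens M) p) := by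
  have h0U : (0 : EuclideanSpace ℝ (Fin p)) ∈ U := mem_of_mem_nhds hU_nhds
  have hcont : Continuous φ.symm := by
    rw [← continuousOn_univ, ← hφ_univ]
    exact φ.continuousOn_symm
  have hsource : ∀ z, φ.symm z ∈ φ.source := fun z => φ.map_target (hφ_univ ▸ Set.mem_univ z)
  have hright : ∀ z, φ (φ.symm z) = z := fun z => φ.right_inv (hφ_univ ▸ Set.mem_univ z)
  -- The plaque `U × {0}` meets `K` at the origin, whereas the plaques at `y i` miss `K`.
  have hy0 : ∀ i, y i ≠ 0 := fun i hi => hyK i 0 h0U (hi ▸ h_zero)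
  -- the restricted chart
  set X : TopologicalSpace.Opens M := ⟨Kᶜ, hK.isOpen_compl⟩ with hX
  have hne : Nonempty X := ⟨⟨φ.symm (0, y 0), hyK 0 0 h0U⟩⟩
  let φ' : FoliationChart p q r X := ⟨φ.subtypeRestr hne,
    subtypeRestr_mem_maximalAtlas_of_mem_maximalAtlas _ hφ hne⟩
  have htarget : ∀ z, z ∈ φ'.1.target ↔ φ.symm z ∉ K := by
    intro z
    constructor
    · intro hz
      rw [← φ.subtypeRestr_symm_apply hne hz]
      exact ((φ.subtypeRestr hne).symm z).2
    · intro hz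
      have := φ.map_subtype_source hne (x := (⟨φ.symm z, hz⟩ : X)) (hsource z)
      rwa [hright] at this
  -- the cutoff functions
  set A : Set (EuclideanSpace ℝ (Fin p)) := U ∩ {x | φ.symm (x, 0) ∈ K} with hAdef
  have hA : IsClosed A :=
    hU_compact.isClosed.inter (hK.preimage (hcont.comp (Continuous.prodMk_left 0)))
  -- A point of `A` outside the interior would be a frontier point of `U` lying over `K`.
  have hAU : A ⊆ interior U := fun x hx => by
    by_contra hxi
    exact hU_frontier x ⟨subset_closure hx.1, hxi⟩ hx.2
  obtain ⟨χ, hχ, hχU, hχc, hχ01, hχ1⟩ := exists_contDiff_cutoff hA hU_compact hAU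
  have h0A : (0 : EuclideanSpace ℝ (Fin p)) ∈ A := ⟨h0U, h_zero⟩
  obtain ⟨h, hh, -, hhc, hh01, hh1⟩ := exists_contDiff_cutoff
    (isClosed_singleton (x := (0 : FoliationModel p q)))
    (isCompact_closedBall (0 : FoliationModel p q) 1) (by
      rw [Set.singleton_subset_iff]
      exact mem_interior_iff_mem_nhds.2 (Metric.closedBall_mem_nhds _ one_pos))
  rw [nhdsSet_singleton] at hh1
  -- the singular forms
  set C : Set X := Subtype.val ⁻¹' (φ.symm '' tsupport h) with hCdef
  -- The Hausdorff property enters here: the compact image of the support of `h` is closed in `M`,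
  -- so extension by zero is legitimate.
  have hC : IsClosed C :=
    (hhc.isCompact.image hcont).isClosed.preimage continuous_subtype_val
  have hsrc' : ∀ m : X, m ∈ φ'.1.source ↔ m.1 ∈ φ.source := fun m => by
    rw [← Set.mem_preimage (f := Subtype.val), ← φ.subtypeRestr_source hne]
  have hCφ : C ⊆ φ'.1.source := by
    rintro m ⟨z, -, hz⟩
    rw [hsrc', ← hz]
    exact hsource z
  -- The power `p + 1` of the inverse square distance outweighs the volume `ε^p` of the small ball;
  -- one more makes the degree strictly larger for every nonzero `P`.
  let a : Polynomial ℝ →ₗ[ℝ] (FoliationModel p q → ℝ) := singularCoeff h (p + 1 + 1)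
  have ha : ∀ P, LeafwiseSmoothOn r (a P) φ'.1.target := fun P =>
    leafwiseSmoothOn_of_contDiffOn φ'.1.open_target fun z hz => by
      have hz0 : z ≠ 0 := by
        rintro rfl
        exact (htarget _).1 hz h_zero
      exact (hh.contDiffAt.mul (contDiffAt_eval_invSqDist _ hz0)).contDiffWithinAt
  have haC : ∀ P, ∀ m ∈ φ'.1.source, m ∉ C → a P (φ'.1 m) = 0 := by
    intro P m hm hmC
    have hzero : h (φ m.1) = 0 := by
      by_contra hne0
      exact hmC ⟨φ m.1, subset_closure hne0, φ.left_inv ((hsrc' m).1 hm)⟩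
    change h (φ m.1) * _ = 0
    rw [hzero, zero_mul]
  let Ω : Polynomial ℝ →ₗ[ℝ] leafwiseForms p q r X p :=
    ((volumeExtension φ').comp a).codRestrict _ fun P =>
      volumeExtension_mem φ' (ha P) hC hCφ (haC P)
  let Φ : Polynomial ℝ →ₗ[ℝ] LeafwiseCohomology p q r X p :=
    (Submodule.mkQ _).comp (Ω.codRestrict (LinearMap.ker (leafwiseD p q r X p)) fun P =>
      leafwiseD_top (Ω P))
  have hΦ : ∀ P, Φ P = 0 → Ω P ∈ exactForms p q r X p := by
    intro P hP
    have hP' : (⟨Ω P, leafwiseD_top (Ω P)⟩ : LinearMap.ker (leafwiseD p q r X p)) ∈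
        (exactForms p q r X p).submoduleOf (LinearMap.ker (leafwiseD p q r X p)) := by
      rw [← Submodule.Quotient.mk_eq_zero]
      exact hP
    exact hP'
  -- forms whose coefficient is positive near the singularity are not exact
  have key : ∀ P : Polynomial ℝ, 0 < P.leadingCoeff → Φ P ≠ 0 := by
    intro P hP hPΦ
    have hyT : ∀ i, ∀ x ∈ tsupport χ, (x, y i) ∈ φ'.1.target := fun i x hx =>
      (htarget _).2 (hyK i x (hχU hx))
    obtain ⟨B, hB⟩ := exists_bound_of_mem_exactForms φ' (hΦ P hPΦ) hχ hχc hy hyT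
      -- A point of the support of `dχ` over `K` would lie in `A`, near which `χ` is constant.
      (fun x hx => (htarget _).2 fun hxK =>
        notMem_tsupport_fderiv_of_eventually_eq_const hχ1
          ⟨hχU (tsupport_fderiv_subset ℝ hx), hxK⟩ hx)
      (EuclideanSpace.basisFun (Fin p) ℝ)
    have hlim := tendsto_integral_mul_eval_invSqDist (μ := MeasureTheory.volume)
      (u := fun z : FoliationModel p q => χ z.1 * h z)
      ((hχ.continuous.comp continuous_fst).mul hh.continuous)
      (fun z => mul_nonneg (hχ01 _).1 (hh01 _).1)
      (fun z => mul_le_one₀ (hχ01 _).2 (hh01 _).1 (hh01 _).2) hU_compact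
      (fun z hz => by
        rw [image_eq_zero_of_notMem_tsupport fun hz' => hz (hχU hz'), zero_mul])
      (by
        have hχ1' : ∀ᶠ z : FoliationModel p q in 𝓝 0, χ z.1 = 1 :=
          (continuous_fst.tendsto (0 : FoliationModel p q)).eventually
            (hχ1.filter_mono (nhds_le_nhdsSet h0A))
        filter_upwards [hχ1', hh1] with z h1 h2
        rw [h1, h2, one_mul]) hy hy0 hP
    obtain ⟨i, hi⟩ := (hlim.eventually_gt_atTop B).exists
    refine absurd (hB i) (not_le.2 (hi.trans_le (le_trans (le_of_eq ?_) (Real.le_norm_self _))))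
    rw [finrank_euclideanSpace, Fintype.card_fin]
    refine MeasureTheory.integral_congr_ae (Filter.Eventually.of_forall fun x => ?_)
    by_cases hx : x ∈ tsupport χ
    · have hval : (Ω P).1 φ' (x, y i) = a P (x, y i) • leafVolume p :=
        volumeExtension_self φ' (a P) (hyT i x hx)
      simp only [hval, ContinuousAlternatingMap.smul_apply, leafVolume_basis, smul_eq_mul, mul_one]
      exact mul_assoc _ _ _
    · simp [image_eq_zero_of_notMem_tsupport hx]
  have hinj : Function.Injective Φ := by
    rw [injective_iff_map_eq_zero]
    intro P hPΦ
    by_contra hP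
    -- By linearity the kernel contains `-P` along with `P`, and one of the two has positive leading
    -- coefficient.
    rcases lt_or_gt_of_ne (Polynomial.leadingCoeff_ne_zero.2 hP) with h | h
    · refine key (-P) ?_ (by rw [map_neg, hPΦ, neg_zero])
      rw [Polynomial.leadingCoeff_neg]
      exact neg_pos.2 h
    · exact key P h hPΦ
  intro hfin
  have hfinP : Module.Finite ℝ (Polynomial ℝ) := Module.Finite.of_injective Φ hinj
  exact Infinite.not_finite (α := ℕ) (Module.Finite.finite_basis (Polynomial.basisMonomials ℝ))
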